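/- Let $P\subset\mathbb R^2$ be a set of $n\ge 3$ points in convex position (no point of $P$ lies in the convex hull of the others), let $\varepsilon\ge 0$, and let $d$ denote the Euclidean distance. A tour of $P$ is a closed polygon that visits every point of $P$ exactly once; a maximum tour is a tour of maximum total length. Algorithm CROSS$'$ works as follows. 1. Find a point $c\in\operatorname{conv}(P)$ that minimizes $\sum_{p\in P}d(c,p)$ up to an additive error of at most $\varepsilon$, i.e. $\sum_{p\in P}d(c,p)\le\sum_{p\in P}d(x,p)+\varepsilon$ for all $x\in\mathbb R^2$. 2. Sort $P$ by angular order around $c$; let the resulting order be $p_1,\dots,p_n$, with indices taken modulo $n$. (If $c$ is itself a point of $P$, that point is given an angle whose opposite direction points from $c$ into $\operatorname{conv}(P)$, as it is seen from points of $\operatorname{conv}(P)$ next to $c$.) 3. If $n$ is odd, connect $p_i$ with $p_{i+(n-1)/2}$ for $i=1,\dots,n$, and return the result. 4. If $n$ is even, connect $p_i$ with $p_{i+n/2-1}$ for $i=1,\dots,n$. Choose an $i$ that maximizes $d(p_i,p_{i+n/2})+d(p_{i+1},p_{i+1+n/2})-d(p_i,p_{i+n/2+1})-d(p_{i+1},p_{i+n/2})$,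 replace the edges $p_ip_{i+n/2+1}$ and $p_{i+1}p_{i+n/2}$ by $p_ip_{i+n/2}$ and $p_{i+1}p_{i+1+n/2}$, and return the result. Then, for every $\varepsilon\ge0$, the algorithm has an output, and every possible output (whatever admissible $c$, sorted order and maximizing index $i$ are chosen) is a maximum tour of $P$. Moreover, if $n$ is odd, then for every $c\in\operatorname{conv}(P)$ and every angular order $p_1,\dots,p_n$ of $P$ around $c$ as in step 2, the maximum tour is unique and its edges are exactly the near-diagonals $p_ip_{i+(n-1)/2}$, $i=1,\dots,n$. -/

import Mathlib

noncomputable section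

namespace MaxTSP

/-- The Euclidean plane. -/
abbrev Plane : Type := EuclideanSpace ℝ (Fin 2)

/-- The Euclidean length of an undirected edge `s(a, b)`, namely `dist a b`. -/
def edgeLength : Sym2 Plane → ℝ :=
  Sym2.lift ⟨fun a b => dist a b, fun a b => dist_comm a b⟩

/-- The total length of a finite set of edges. -/
def totalLength (T : Finset (Sym2 Plane)) : ℝ := ∑ e ∈ T, edgeLength e

/-- The points `p i` (`i` modulo `n`) are pairwise distinct and are exactly the points of `P`. -/
def Enumerates (P : Finset Plane) (p : ZMod P.card → Plane) : Prop :=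
  Function.Injective p ∧ Set.range p = (P : Set Plane)

open Classical in
/-- All the edges obtained by connecting `p i` with `p (i + k)`, indices modulo `n`. -/
def connectAll {n : ℕ} (p : ZMod n → Plane) (k : ℕ) : Finset (Sym2 Plane) :=
  (Finset.range n).image fun i : ℕ => s(p i, p (i + k))

/-- `T` is (the edge set of) a tour of `P`: a closed polygon through all points of `P` that visits
each of them exactly once (for at least three points). -/
def IsTour (P : Finset Plane) (T : Finset (Sym2 Plane)) : Prop :=
  ∃ q : ZMod P.card → Plane, Enumerates P q ∧ T = connectAll q 1

/-- `T` is a maximum travelling salesman tour of `P`. -/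
def IsMaxTour (P : Finset Plane) (T : Finset (Sym2 Plane)) : Prop :=
  IsTour P T ∧ ∀ T', IsTour P T' → totalLength T' ≤ totalLength T

/-- The points of `P` are in convex position: none of them is in the convex hull of the others. -/
def InConvexPosition (P : Finset Plane) : Prop :=
  ConvexIndependent ℝ (fun x : P => (x : Plane))

/-- The Fermat-Weber objective: the sum of the distances from `c` to the points of `P`. -/
def fermatWeber (P : Finset Plane) (c : Plane) : ℝ := ∑ x ∈ P, dist c x

/-- Step 1: `c` is a point of the convex hull of `P` that minimizes the Fermat-Weber objective
over the whole plane up to an additive error of at most `ε`. -/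
def IsApproxCenter (P : Finset Plane) (ε : ℝ) (c : Plane) : Prop :=
  c ∈ convexHull ℝ (P : Set Plane) ∧ ∀ x : Plane, fermatWeber P c ≤ fermatWeber P x + ε

/-- The unit vector of polar angle `t`. -/
def unitVec (t : ℝ) : Plane := !₂[Real.cos t, Real.sin t]

/-- Step 2: `p 0, …, p (n - 1)` lists the points of `P` by (counterclockwise) angular order
around `c`: there are polar angles `θ 0 ≤ … ≤ θ (n - 1) < θ 0 + 2π` of the vectors `p i - c`.
If `c` is itself one of the points, the angle of that point is any angle that it has as seen from
points next to `c` in the convex hull of `P`, i.e. any angle whose opposite points from `c` into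
the convex hull. -/
def IsAngularOrder (P : Finset Plane) (c : Plane) (p : ZMod P.card → Plane) : Prop :=
  Enumerates P p ∧
  ∃ θ : ℕ → ℝ,
    (∀ i j : ℕ, i ≤ j → j < P.card → θ i ≤ θ j) ∧
    (∀ i : ℕ, i < P.card → θ i < θ 0 + 2 * Real.pi) ∧
    (∀ i : ℕ, i < P.card → p i = c + dist (p i) c • unitVec (θ i)) ∧
    (∀ i : ℕ, i < P.card → p i = c →
      ∃ r : ℝ, 0 < r ∧ c - r • unitVec (θ i) ∈ convexHull ℝ (P : Set Plane))

/-- The change of length when the near-diagonals `p i p (i+n/2+1)` and `p (i+1) p (i+n/2)` are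
replaced by the diagonals `p i p (i+n/2)` and `p (i+1) p (i+1+n/2)`. -/
def exchangeGain {n : ℕ} (p : ZMod n → Plane) (i : ZMod n) : ℝ :=
  dist (p i) (p (i + (n / 2 : ℕ))) + dist (p (i + 1)) (p (i + 1 + (n / 2 : ℕ)))
    - dist (p i) (p (i + (n / 2 : ℕ) + 1)) - dist (p (i + 1)) (p (i + (n / 2 : ℕ)))

open Classical in
/-- The result of executing that 2-exchange on an edge set `T`. -/
def exchange {n : ℕ} (p : ZMod n → Plane) (i : ZMod n) (T : Finset (Sym2 Plane)) :
    Finset (Sym2 Plane) :=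
  (T \ {s(p i, p (i + (n / 2 : ℕ) + 1)), s(p (i + 1), p (i + (n / 2 : ℕ)))}) ∪
    {s(p i, p (i + (n / 2 : ℕ))), s(p (i + 1), p (i + 1 + (n / 2 : ℕ)))}

/-- Steps 3 to 6: `T` is a possible result on the list `p 0, …, p (n - 1)`.  For odd `n`, connect
every `p i` with `p (i + (n - 1) / 2)`.  For even `n`, connect every `p i` with
`p (i + n / 2 - 1)`, and then execute a 2-exchange of largest gain. -/
def TourFromOrder {n : ℕ} (p : ZMod n → Plane) (T : Finset (Sym2 Plane)) : Prop :=
  (Odd n ∧ T = connectAll p ((n - 1) / 2)) ∨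
  (Even n ∧ ∃ i : ZMod n, (∀ j : ZMod n, exchangeGain p j ≤ exchangeGain p i) ∧
    T = exchange p i (connectAll p (n / 2 - 1)))

/-- `T` is a possible output of the heuristic CROSS' on the input `P`, when its first step is
carried out with accuracy `ε`. -/
def IsCrossOutput (P : Finset Plane) (ε : ℝ) (T : Finset (Sym2 Plane)) : Prop :=
  ∃ c : Plane, IsApproxCenter P ε c ∧
    ∃ p : ZMod P.card → Plane, IsAngularOrder P c p ∧ TourFromOrder p T

end MaxTSP

end

/-! Seen from any centre in the convex hull, a point set in convex position appears in its convex
cyclic order (`orient_pos`). So the quality of the centre is irrelevant to optimality, and only the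
combinatorics of a convex polygon remains.

A pair of gaps (a, b) in the cyclic order splits the points into two arcs. The distance is a
combination of the cut functions of these splits, with weight the mixed second difference W(a, b) =
`crossDiff` (`sum_crossDiff_separates`). By the strict quadrangle inequality W(a, b) > 0 for a ≠ b
(`crossDiff_pos`). Four times the length of a tour is therefore the sum of W(a, b) times the number
of its edges crossing the split (`four_mul_sum_eq_sum_cut`), and a tour that maximizes every
crossing number is longest. A crossing number is maximal as soon as one of the two sides contains no
edge of the tour.

For n = 2u + 1, one side of every split has at most u points and contains no near-diagonal, so the
near-diagonals maximize all crossing numbers at once. Any other edge lies within such a side, which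
gives uniqueness (`nearDiagonals_optimal`).

For n = 2m, the same argument covers all splits except the halving ones. By parity, a tour crosses a
halving split n times or at most n - 2 times, and by connectedness n times for at most one such
split (`eq_of_cut_eq`). The exchanged tour attains n at the split (i, i + m) and at least n - 2 at
all others. The gain of the exchange is W(i, i + m), so an exchange of largest gain places the full
crossing on the heaviest halving split (`exchange_zero_optimal`). -/

namespace MaxTSP

/-! ### Cut decomposition of a cyclically ordered metric -/

section Cuts

variable {n : ℕ} [NeZero n]

theorem val_add_natCast (a : ZMod n) {u : ℕ} (hu : u < n) :
    (a + (u : ZMod n)).val = if a.val + u < n then a.val + u else a.val + u - n := by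
  have ha := ZMod.val_lt a
  rw [ZMod.val_add, ZMod.val_natCast_of_lt hu]
  split_ifs with h
  · exact Nat.mod_eq_of_lt h
  · rw [Nat.mod_eq_sub_mod (by omega), Nat.mod_eq_of_lt (by omega)]

theorem val_add_one' (hn : 1 < n) (a : ZMod n) :
    (a + 1).val = if a.val + 1 < n then a.val + 1 else 0 := by
  have h := val_add_natCast a hn
  have ha := ZMod.val_lt a
  rw [Nat.cast_one] at h
  rw [h]
  split_ifs <;> omega

/-- The mixed second difference of `d` at the pair `(a, b)`, for cyclic indices. -/
def crossDiff (d : ZMod n → ZMod n → ℝ) (a b : ZMod n) : ℝ :=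
  d a b + d (a + 1) (b + 1) - d a (b + 1) - d (a + 1) b

/-- `x` lies on the arc cut off by the gaps after `a` and after `b` that avoids `0`. -/
def InArc (a b x : ZMod n) : Prop := ¬ (a.val < x.val ↔ b.val < x.val)

/-- The arc between the gaps after `a` and after `b` separates `x` from `y`. -/
def Separates (a b x y : ZMod n) : Prop := ¬ (InArc a b x ↔ InArc a b y)

/-- The indicator of `a.val < x.val`. -/
def below (x a : ZMod n) : ℝ := if a.val < x.val then 1 else 0

/-- The spike at `0` comes from the wrap-around. It does not depend on `x`, so it cancels in `below
x - below y`. -/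
theorem below_add_one_sub_below (hn : 1 < n) (x a : ZMod n) :
    below x (a + 1) - below x a = (if a + 1 = 0 then 1 else 0) - (if a + 1 = x then 1 else 0) := by
  have ha := ZMod.val_lt a
  have hx := ZMod.val_lt x
  have hv := val_add_one' hn a
  have h0 : a + 1 = 0 ↔ a.val + 1 = n := by
    rw [← ZMod.val_eq_zero, hv]
    by_cases h2 : a.val + 1 < n
    · rw [if_pos h2]
      omega
    · rw [if_neg h2]
      omega
  have h1 : a + 1 = x ↔ (if a.val + 1 < n then a.val + 1 else 0) = x.val := by
    rw [← (ZMod.val_injective n).eq_iff, hv]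
  simp only [below, h0, h1]
  generalize (a + 1).val = v at *
  by_cases h2 : a.val + 1 < n
  · rw [if_pos h2] at hv ⊢
    subst hv
    split_ifs <;> first | omega | norm_num
  · rw [if_neg h2] at hv ⊢
    subst hv
    split_ifs <;> first | omega | norm_num

theorem sum_crossDiff_right (d : ZMod n → ZMod n → ℝ) (a : ZMod n) :
    ∑ b, crossDiff d a b = 0 := by
  have h1 : ∑ b, d (a + 1) (b + 1) = ∑ b, d (a + 1) b :=
    Equiv.sum_comp (Equiv.addRight (1 : ZMod n)) fun b => d (a + 1) b
  have h2 : ∑ b, d a (b + 1) = ∑ b, d a b :=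
    Equiv.sum_comp (Equiv.addRight (1 : ZMod n)) fun b => d a b
  simp only [crossDiff, Finset.sum_sub_distrib, Finset.sum_add_distrib, h1, h2]
  ring

theorem sum_crossDiff_left (d : ZMod n → ZMod n → ℝ) (b : ZMod n) :
    ∑ a, crossDiff d a b = 0 := by
  have h1 : ∑ a, d (a + 1) (b + 1) = ∑ a, d a (b + 1) :=
    Equiv.sum_comp (Equiv.addRight (1 : ZMod n)) fun a => d a (b + 1)
  have h2 : ∑ a, d (a + 1) b = ∑ a, d a b :=
    Equiv.sum_comp (Equiv.addRight (1 : ZMod n)) fun a => d a b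
  simp only [crossDiff, Finset.sum_sub_distrib, Finset.sum_add_distrib, h1, h2]
  ring

theorem sum_diff_mul (f g : ZMod n → ℝ) :
    ∑ a, (f a - f (a + 1)) * g a = ∑ a, f (a + 1) * (g (a + 1) - g a) := by
  have h : ∑ a, f (a + 1) * g (a + 1) = ∑ a, f a * g a :=
    Equiv.sum_comp (Equiv.addRight (1 : ZMod n)) fun a => f a * g a
  simp only [sub_mul, mul_sub, Finset.sum_sub_distrib, h]

/-- Cyclic summation by parts in each variable; there are no boundary terms. -/
theorem sum_crossDiff_mul_mul (d : ZMod n → ZMod n → ℝ) (g : ZMod n → ℝ) :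
    ∑ a, ∑ b, crossDiff d a b * (g a * g b) =
      ∑ a, ∑ b, d (a + 1) (b + 1) * ((g (a + 1) - g a) * (g (b + 1) - g b)) := by
  have h1 : ∀ a, ∑ b, crossDiff d a b * (g a * g b) =
      ((∑ b, d a (b + 1) * (g (b + 1) - g b)) - ∑ b, d (a + 1) (b + 1) * (g (b + 1) - g b))
        * g a := by
    intro a
    rw [← sum_diff_mul, ← sum_diff_mul, ← Finset.sum_sub_distrib, Finset.sum_mul]
    refine Finset.sum_congr rfl fun b _ => ?_
    simp only [crossDiff]
    ring
  simp only [h1]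
  rw [sum_diff_mul fun a => ∑ b, d a (b + 1) * (g (b + 1) - g b)]
  refine Finset.sum_congr rfl fun a _ => ?_
  rw [Finset.sum_mul]
  refine Finset.sum_congr rfl fun b _ => ?_
  ring

open Classical in
/-- A symmetric function vanishing on the diagonal is a combination of cut functions of arcs. -/
theorem sum_crossDiff_separates (hn : 1 < n) (d : ZMod n → ZMod n → ℝ)
    (hd : ∀ x y, d x y = d y x) (hd0 : ∀ x, d x x = 0) (x y : ZMod n) :
    ∑ a, ∑ b, crossDiff d a b * (if Separates a b x y then 1 else 0) = 4 * d x y := by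
  set g : ZMod n → ℝ := fun a => below x a - below y a with hg
  -- Since `g` vanishes or has one fixed sign with absolute value 1, the indicator is `(g a - g b) ^
  -- 2`. The pure squares drop out because rows and columns of `crossDiff` sum to zero.
  have hs : ∀ a b, (if Separates a b x y then (1 : ℝ) else 0) =
      g a ^ 2 + g b ^ 2 - 2 * (g a * g b) := by
    intro a b
    simp only [hg, below, Separates, InArc]
    by_cases h1 : a.val < x.val <;> by_cases h2 : b.val < x.val <;>
      by_cases h3 : a.val < y.val <;> by_cases h4 : b.val < y.val <;>
      first | omega | norm_num [h1, h2, h3, h4]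
  have h1 : ∀ a b, crossDiff d a b * (if Separates a b x y then 1 else 0) =
      crossDiff d a b * g a ^ 2 + crossDiff d a b * g b ^ 2
        - 2 * (crossDiff d a b * (g a * g b)) := by
    intro a b
    rw [hs]
    ring
  simp only [h1, Finset.sum_sub_distrib, Finset.sum_add_distrib]
  have h2 : ∑ a, ∑ b, crossDiff d a b * g a ^ 2 = 0 := by
    simp only [← Finset.sum_mul, sum_crossDiff_right, zero_mul, Finset.sum_const_zero]
  have h3 : ∑ a, ∑ b, crossDiff d a b * g b ^ 2 = 0 := by
    rw [Finset.sum_comm]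
    simp only [← Finset.sum_mul, sum_crossDiff_left, zero_mul, Finset.sum_const_zero]
  -- Two summations by parts leave `d` tested against differences of point masses at `y` and `x`;
  -- only the two mixed terms survive.
  have h4 : ∑ a, ∑ b, crossDiff d a b * (g a * g b) = - (2 * d x y) := by
    rw [sum_crossDiff_mul_mul]
    have hgd : ∀ a, g (a + 1) - g a =
        (if a + 1 = y then 1 else 0) - (if a + 1 = x then 1 else 0) := by
      intro a
      have hx := below_add_one_sub_below hn x a
      have hy := below_add_one_sub_below hn y a
      simp only [hg]
      linarith
    simp only [hgd]
    have hshift : ∀ F : ZMod n → ZMod n → ℝ,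
        ∑ a, ∑ b, F (a + 1) (b + 1) = ∑ a, ∑ b, F a b := fun F =>
      (Equiv.sum_comp (Equiv.addRight (1 : ZMod n)) fun a => ∑ b, F a (b + 1)).trans
        (Finset.sum_congr rfl fun a _ =>
          Equiv.sum_comp (Equiv.addRight (1 : ZMod n)) fun b => F a b)
    refine (hshift fun a b => d a b * (((if a = y then 1 else 0) - (if a = x then 1 else 0)) *
        ((if b = y then 1 else 0) - (if b = x then 1 else 0)))).trans ?_
    simp only [mul_sub, Finset.sum_sub_distrib, mul_ite, mul_one, mul_zero, Finset.sum_ite_eq',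
      Finset.mem_univ, if_true]
    rw [hd0, hd0, hd y x]
    ring
  simp only [← Finset.mul_sum]
  rw [h2, h3, h4]
  ring

end Cuts

/-! ### Tours as cyclic permutations of the indices -/

section Tours

variable {n : ℕ} [NeZero n]

open Classical in
/-- The number of edges of the closed walk `τ` that the arc `(a, b)` separates. -/
noncomputable def cut (τ : ZMod n → ZMod n) (a b : ZMod n) : ℕ :=
  (Finset.univ.filter fun k => Separates a b (τ k) (τ (k + 1))).card

theorem four_mul_sum_eq_sum_cut (hn : 1 < n) (d : ZMod n → ZMod n → ℝ)
    (hd : ∀ x y, d x y = d y x) (hd0 : ∀ x, d x x = 0) (τ : ZMod n → ZMod n) :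
    4 * ∑ k, d (τ k) (τ (k + 1)) = ∑ a, ∑ b, crossDiff d a b * cut τ a b := by
  classical
  rw [Finset.mul_sum]
  simp only [← sum_crossDiff_separates hn d hd hd0]
  rw [Finset.sum_comm]
  refine Finset.sum_congr rfl fun a _ => ?_
  rw [Finset.sum_comm]
  refine Finset.sum_congr rfl fun b _ => ?_
  rw [← Finset.mul_sum, Finset.sum_boole, cut]

theorem cut_self (τ : ZMod n → ZMod n) (a : ZMod n) : cut τ a a = 0 := by
  classical
  simp [cut, Separates, InArc]

theorem cut_le (τ : ZMod n → ZMod n) (a b : ZMod n) : cut τ a b ≤ n := by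
  classical
  refine (Finset.card_filter_le _ _).trans ?_
  rw [Finset.card_univ, ZMod.card]

theorem cut_eq_iff (τ : ZMod n → ZMod n) (a b : ZMod n) :
    cut τ a b = n ↔ ∀ k, Separates a b (τ k) (τ (k + 1)) := by
  classical
  have h : n = (Finset.univ : Finset (ZMod n)).card := by rw [Finset.card_univ, ZMod.card]
  conv_lhs => rhs; rw [h]
  rw [cut, Finset.card_filter_eq_iff]
  simp

/-- Double counting of the edges leaving a set `O` of vertices of a closed tour. -/
theorem card_separated_add {τ : ZMod n → ZMod n} (hτ : Function.Bijective τ) {A : ZMod n → Prop}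
    {S I O : Finset (ZMod n)} (hS : ∀ k, k ∈ S ↔ ¬ (A (τ k) ↔ A (τ (k + 1))))
    (hI : ∀ k, k ∈ I ↔ A (τ k) ∧ A (τ (k + 1))) (hO : ∀ x, x ∈ O ↔ A x) :
    S.card + 2 * I.card = 2 * O.card := by
  classical
  have hcard : ∀ F : Finset (ZMod n), F.card = ∑ k, if k ∈ F then 1 else 0 := fun F => by simp
  have h1 : ∑ k, (if A (τ k) then 1 else 0) = O.card := by
    rw [hcard O]
    simp only [hO]
    exact Equiv.sum_comp (Equiv.ofBijective τ hτ) fun x => if A x then 1 else 0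
  have h2 : ∑ k, (if A (τ (k + 1)) then 1 else 0) = O.card := by
    rw [← h1]
    exact Equiv.sum_comp (Equiv.addRight (1 : ZMod n)) fun k => if A (τ k) then 1 else 0
  rw [two_mul O.card]
  nth_rewrite 1 [← h1]
  rw [← h2, ← Finset.sum_add_distrib, hcard S, hcard I, Finset.mul_sum, ← Finset.sum_add_distrib]
  refine Finset.sum_congr rfl fun k _ => ?_
  by_cases hA : A (τ k) <;> by_cases hB : A (τ (k + 1)) <;> simp [hS, hI, hA, hB]

-- The right-hand side does not depend on the tour, so a larger cut means exactly fewer edges inside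
-- the arc.
open Classical in
theorem cut_add_two_mul_inside {τ : ZMod n → ZMod n} (hτ : Function.Bijective τ) (a b : ZMod n) :
    cut τ a b + 2 * (Finset.univ.filter fun k => InArc a b (τ k) ∧ InArc a b (τ (k + 1))).card =
      2 * (Finset.univ.filter fun x => InArc a b x).card := by
  refine card_separated_add hτ (A := InArc a b) (fun k => ?_) (fun k => ?_) fun k => ?_ <;>
    rw [Finset.mem_filter_univ]
  rfl

open Classical in
theorem cut_add_two_mul_outside {τ : ZMod n → ZMod n} (hτ : Function.Bijective τ)
    (a b : ZMod n) :
    cut τ a b +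
      2 * (Finset.univ.filter fun k => ¬ InArc a b (τ k) ∧ ¬ InArc a b (τ (k + 1))).card =
      2 * (Finset.univ.filter fun x => ¬ InArc a b x).card := by
  refine card_separated_add hτ (A := fun x => ¬ InArc a b x) (fun k => ?_) (fun k => ?_)
    fun k => ?_ <;> rw [Finset.mem_filter_univ]
  rw [not_iff_not (a := InArc _ _ _)]
  rfl

theorem cut_even {τ : ZMod n → ZMod n} (hτ : Function.Bijective τ) (a b : ZMod n) :
    Even (cut τ a b) := by
  classical
  have h := cut_add_two_mul_inside hτ a b
  rw [Nat.even_iff]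
  omega

/-- If no edge of `τ` stays on one of the two sides of an arc, then `τ` has the largest possible
cut for that arc. -/
theorem cut_le_cut {τ σ : ZMod n → ZMod n} (hτ : Function.Bijective τ)
    (hσ : Function.Bijective σ) (a b : ZMod n)
    (h : (∀ k, ¬ (InArc a b (τ k) ∧ InArc a b (τ (k + 1)))) ∨
      ∀ k, ¬ (¬ InArc a b (τ k) ∧ ¬ InArc a b (τ (k + 1)))) :
    cut σ a b ≤ cut τ a b := by
  classical
  rcases h with h | h
  · have h1 := cut_add_two_mul_inside hτ a b
    have h2 := cut_add_two_mul_inside hσ a b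
    rw [Finset.filter_false_of_mem fun k _ => h k, Finset.card_empty] at h1
    omega
  · have h1 := cut_add_two_mul_outside hτ a b
    have h2 := cut_add_two_mul_outside hσ a b
    rw [Finset.filter_false_of_mem fun k _ => h k, Finset.card_empty] at h1
    omega

/-- The strict comparison behind uniqueness: one edge of `σ` on a side where `τ` has none already
lowers the cut. -/
theorem cut_lt_cut {τ σ : ZMod n → ZMod n} (hτ : Function.Bijective τ)
    (hσ : Function.Bijective σ) (a b : ZMod n)
    (h : (∀ k, ¬ (InArc a b (τ k) ∧ InArc a b (τ (k + 1)))) ∧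
        (∃ k, InArc a b (σ k) ∧ InArc a b (σ (k + 1))) ∨
      (∀ k, ¬ (¬ InArc a b (τ k) ∧ ¬ InArc a b (τ (k + 1)))) ∧
        ∃ k, ¬ InArc a b (σ k) ∧ ¬ InArc a b (σ (k + 1))) :
    cut σ a b < cut τ a b := by
  classical
  rcases h with ⟨h, k, hk⟩ | ⟨h, k, hk⟩
  · have h1 := cut_add_two_mul_inside hτ a b
    have h2 := cut_add_two_mul_inside hσ a b
    have h3 : 0 < (Finset.univ.filter fun k =>
        InArc a b (σ k) ∧ InArc a b (σ (k + 1))).card :=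
      Finset.card_pos.2 ⟨k, by simpa using hk⟩
    rw [Finset.filter_false_of_mem fun k _ => h k, Finset.card_empty] at h1
    omega
  · have h1 := cut_add_two_mul_outside hτ a b
    have h2 := cut_add_two_mul_outside hσ a b
    have h3 : 0 < (Finset.univ.filter fun k =>
        ¬ InArc a b (σ k) ∧ ¬ InArc a b (σ (k + 1))).card :=
      Finset.card_pos.2 ⟨k, by simpa using hk⟩
    rw [Finset.filter_false_of_mem fun k _ => h k, Finset.card_empty] at h1
    omega

theorem sum_le_sum_of_cut (hn : 1 < n) {d : ZMod n → ZMod n → ℝ}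
    (hd : ∀ x y, d x y = d y x) (hd0 : ∀ x, d x x = 0)
    (hW : ∀ a b, a ≠ b → 0 < crossDiff d a b) {τ σ : ZMod n → ZMod n}
    (h : ∀ a b, a ≠ b → cut σ a b ≤ cut τ a b) :
    ∑ k, d (σ k) (σ (k + 1)) ≤ ∑ k, d (τ k) (τ (k + 1)) := by
  have h1 := four_mul_sum_eq_sum_cut hn d hd hd0 τ
  have h2 := four_mul_sum_eq_sum_cut hn d hd hd0 σ
  have h3 : ∑ a, ∑ b, crossDiff d a b * cut σ a b ≤ ∑ a, ∑ b, crossDiff d a b * cut τ a b := by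
    refine Finset.sum_le_sum fun a _ => Finset.sum_le_sum fun b _ => ?_
    by_cases hab : a = b
    · rw [hab, cut_self, cut_self]
    · exact mul_le_mul_of_nonneg_left (by exact_mod_cast h a b hab) (hW a b hab).le
  linarith

theorem sum_lt_sum_of_cut (hn : 1 < n) {d : ZMod n → ZMod n → ℝ}
    (hd : ∀ x y, d x y = d y x) (hd0 : ∀ x, d x x = 0)
    (hW : ∀ a b, a ≠ b → 0 < crossDiff d a b) {τ σ : ZMod n → ZMod n}
    (h : ∀ a b, a ≠ b → cut σ a b ≤ cut τ a b) {a₀ b₀ : ZMod n}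
    (h0 : cut σ a₀ b₀ < cut τ a₀ b₀) :
    ∑ k, d (σ k) (σ (k + 1)) < ∑ k, d (τ k) (τ (k + 1)) := by
  have h1 := four_mul_sum_eq_sum_cut hn d hd hd0 τ
  have h2 := four_mul_sum_eq_sum_cut hn d hd hd0 σ
  have hle : ∀ a b, crossDiff d a b * cut σ a b ≤ crossDiff d a b * cut τ a b := by
    intro a b
    by_cases hab : a = b
    · rw [hab, cut_self, cut_self]
    · exact mul_le_mul_of_nonneg_left (by exact_mod_cast h a b hab) (hW a b hab).le
  have hne : a₀ ≠ b₀ := by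
    rintro rfl
    simp [cut_self] at h0
  have h3 : ∑ a, ∑ b, crossDiff d a b * cut σ a b < ∑ a, ∑ b, crossDiff d a b * cut τ a b := by
    refine Finset.sum_lt_sum (fun a _ => Finset.sum_le_sum fun b _ => hle a b)
      ⟨a₀, Finset.mem_univ _, Finset.sum_lt_sum (fun b _ => hle a₀ b)
        ⟨b₀, Finset.mem_univ _, ?_⟩⟩
    exact mul_lt_mul_of_pos_left (by exact_mod_cast h0) (hW _ _ hne)
  linarith

/-! ### Edge sets -/

open Classical in
theorem connectAll_eq_image_univ (p : ZMod n → Plane) (k : ℕ) :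
    connectAll p k = Finset.univ.image fun i : ZMod n => s(p i, p (i + k)) := by
  ext e
  simp only [connectAll, Finset.mem_image, Finset.mem_range, Finset.mem_univ, true_and]
  constructor
  · rintro ⟨i, _, rfl⟩
    exact ⟨i, rfl⟩
  · rintro ⟨i, rfl⟩
    exact ⟨i.val, ZMod.val_lt i, by simp⟩

theorem mem_connectAll {p : ZMod n → Plane} {k : ℕ} {e : Sym2 Plane} :
    e ∈ connectAll p k ↔ ∃ i : ZMod n, s(p i, p (i + k)) = e := by
  classical
  simp [connectAll_eq_image_univ]

omit [NeZero n] in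
theorem edge_injective {α : Type*} (hn : 2 < n) {q : ZMod n → α} (hq : Function.Injective q) :
    Function.Injective fun i : ZMod n => s(q i, q (i + 1)) := by
  intro i j hij
  rcases Sym2.eq_iff.1 hij with ⟨h, _⟩ | ⟨h1, h2⟩
  · exact hq h
  -- Two edges that agree with reversed ends would force 2 = 0 modulo n, impossible for n > 2.
  · have h1 := hq h1
    have h2 := hq h2
    exfalso
    have h3 : ((2 : ℕ) : ZMod n) = 0 := by
      push_cast
      linear_combination h2 - h1
    rw [ZMod.natCast_eq_zero_iff] at h3
    exact absurd (Nat.le_of_dvd (by norm_num) h3) (by omega)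

theorem card_connectAll_one (hn : 2 < n) {q : ZMod n → Plane} (hq : Function.Injective q) :
    (connectAll q 1).card = n := by
  classical
  rw [connectAll_eq_image_univ, Finset.card_image_of_injective, Finset.card_univ, ZMod.card]
  simpa using edge_injective hn hq

theorem totalLength_connectAll_one (hn : 2 < n) {q : ZMod n → Plane}
    (hq : Function.Injective q) :
    totalLength (connectAll q 1) = ∑ k, dist (q k) (q (k + 1)) := by
  classical
  have h := edge_injective hn hq
  rw [totalLength, connectAll_eq_image_univ, Finset.sum_image]
  · simp [edgeLength]
  · simpa using h

omit [NeZero n] in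
theorem card_connectAll_le (p : ZMod n → Plane) (k : ℕ) : (connectAll p k).card ≤ n := by
  classical
  exact Finset.card_image_le.trans (by simp)

end Tours
/-! ### Orientation of triples in the plane -/

/-- Twice the signed area of the triangle `a b c`. -/
def orient (a b c : Plane) : ℝ :=
  (b 0 - a 0) * (c 1 - a 1) - (b 1 - a 1) * (c 0 - a 0)

theorem orient_rotate (a b c : Plane) : orient b c a = orient a b c := by
  simp only [orient]
  ring

theorem plane_ext {a b : Plane} (h0 : a 0 = b 0) (h1 : a 1 = b 1) : a = b := by
  ext i
  fin_cases i
  · exact h0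
  · exact h1

theorem orient_eq_zero_of_wbtw {a b c : Plane} (h : Wbtw ℝ a b c) : orient a b c = 0 := by
  obtain ⟨t, _, rfl⟩ := h
  simp [orient, AffineMap.lineMap_apply]
  ring

theorem dist_lt_of_orient_ne_zero {a b c : Plane} (h : orient a b c ≠ 0) :
    dist a c < dist a b + dist b c :=
  lt_of_le_of_ne (dist_triangle a b c) fun he =>
    h (orient_eq_zero_of_wbtw (dist_add_dist_eq_iff.1 he.symm))

/-- In a strictly convex quadrilateral the diagonals together are longer than two opposite
sides. -/
theorem dist_add_dist_lt_of_orient {a b c d : Plane} (h1 : 0 < orient a b c)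
    (h2 : 0 < orient a b d) (h3 : 0 < orient a c d) (h4 : 0 < orient b c d) :
    dist a d + dist b c < dist a c + dist b d := by
  -- The diagonals meet at parameter `t` on `ac` and `s` on `bd`. Both are ratios of triangle areas,
  -- whose denominators agree: each is twice the area of the quadrilateral.
  set t := orient a b d / (orient a b d + orient b c d) with ht
  set s := orient a b c / (orient a b c + orient a c d) with hs
  have hsum : orient a b d + orient b c d = orient a b c + orient a c d := by
    simp only [orient]
    ring
  have ht0 : 0 < t := by positivity
  have hs0 : 0 < s := by positivity
  have ht1 : t ≤ 1 := (div_le_one (by positivity)).2 (by linarith)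
  have hs1 : s ≤ 1 := (div_le_one (by positivity)).2 (by linarith)
  have hx : AffineMap.lineMap a c t = AffineMap.lineMap b d s := by
    have hne : orient a b c + orient a c d ≠ 0 := by positivity
    rw [hsum] at ht
    apply plane_ext
    · simp only [AffineMap.lineMap_apply, ht, hs, vsub_eq_sub, vadd_eq_add, PiLp.add_apply,
        PiLp.smul_apply, PiLp.sub_apply, smul_eq_mul]
      field_simp
      simp only [orient]
      ring
    · simp only [AffineMap.lineMap_apply, ht, hs, vsub_eq_sub, vadd_eq_add, PiLp.add_apply,
        PiLp.smul_apply, PiLp.sub_apply, smul_eq_mul]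
      field_simp
      simp only [orient]
      ring
  set x := AffineMap.lineMap a c t with hxdef
  have hac : dist a x + dist x c = dist a c := dist_add_dist_eq_iff.2 ⟨t, ⟨ht0.le, ht1⟩, rfl⟩
  have hbd : dist b x + dist x d = dist b d :=
    dist_add_dist_eq_iff.2 ⟨s, ⟨hs0.le, hs1⟩, hx.symm⟩
  have had : dist a d < dist a x + dist x d := by
    apply dist_lt_of_orient_ne_zero
    have : orient a x d = t * orient a c d := by
      simp only [orient, hxdef, AffineMap.lineMap_apply, vsub_eq_sub, vadd_eq_add,
        PiLp.add_apply, PiLp.smul_apply, PiLp.sub_apply, smul_eq_mul]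
      ring
    rw [this]
    positivity
  have hbc := dist_triangle b x c
  linarith

/-! ### Convex position -/

theorem notMem_convexHull_sdiff {P : Finset Plane} (hP : InConvexPosition P)
    {x : Plane} (hx : x ∈ P) : x ∉ convexHull ℝ ((P : Set Plane) \ {x}) := by
  have h : ∀ y ∈ (P : Set Plane), y ∉ convexHull ℝ ((P : Set Plane) \ {y}) :=
    convexIndependent_set_iff_notMem_convexHull_sdiff.1 hP
  exact h x hx

/-- A point of `P` is not a nontrivial convex combination of a point of `conv P` and other
points of `P`. -/
theorem false_of_combination {P : Finset Plane} (hP : InConvexPosition P) {x u v y : Plane}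
    (hx : x ∈ P) (hu : u ∈ P) (hv : v ∈ P) (hux : u ≠ x) (hvx : v ≠ x)
    (hy : y ∈ convexHull ℝ (P : Set Plane)) {A B C : ℝ} (hA : 0 ≤ A) (hB : 0 ≤ B) (hC : 0 ≤ C)
    (hAB : 0 < A + B) (h : A • (u - x) + B • (v - x) + C • (y - x) = 0) : False := by
  have hnot := notMem_convexHull_sdiff hP hx
  have hins : (P : Set Plane) = insert x ((P : Set Plane) \ {x}) := by
    rw [Set.insert_sdiff_singleton, Set.insert_eq_of_mem (by exact_mod_cast hx)]
  have hu' : u ∈ convexHull ℝ ((P : Set Plane) \ {x}) :=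
    subset_convexHull _ _ ⟨by exact_mod_cast hu, hux⟩
  have hv' : v ∈ convexHull ℝ ((P : Set Plane) \ {x}) :=
    subset_convexHull _ _ ⟨by exact_mod_cast hv, hvx⟩
  have hne : ((P : Set Plane) \ {x}).Nonempty := ⟨u, by exact_mod_cast hu, hux⟩
  -- Write `y` as a convex combination of `x` and some `z` in the hull of the other points. Solving
  -- the relation for `x` gives weights proportional to `A`, `B`, `C * t` on `u`, `v`, `z`, with
  -- positive total because `A + B > 0`.
  rw [hins, convexHull_insert hne, mem_convexJoin] at hy
  obtain ⟨x', hx', z, hz, hyz⟩ := hy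
  rw [Set.mem_singleton_iff] at hx'
  subst hx'
  obtain ⟨s, t, hs, ht, hst, rfl⟩ := hyz
  apply hnot
  have hS : 0 < A + B + C * t := by positivity
  have hxe : x' = (A / (A + B + C * t)) • u + (B / (A + B + C * t)) • v +
      (C * t / (A + B + C * t)) • z := by
    have hs' : s = 1 - t := by linarith
    subst hs'
    have h2 : (A + B + C * t) • x' = A • u + B • v + (C * t) • z := by
      have : A • u + B • v + (C * t) • z - (A + B + C * t) • x' =
        A • (u - x') + B • (v - x') + C • ((1 - t) • x' + t • z - x') := by module
      rw [← sub_eq_zero, ← neg_sub, this, h, neg_zero]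
    rw [div_eq_inv_mul, div_eq_inv_mul, div_eq_inv_mul, mul_smul, mul_smul, mul_smul,
      ← smul_add, ← smul_add, ← h2, smul_smul, inv_mul_cancel₀ hS.ne', one_smul]
  have hmem := (convex_convexHull ℝ ((P : Set Plane) \ {x'})).sum_mem (t := Finset.univ)
    (w := ![A / (A + B + C * t), B / (A + B + C * t), C * t / (A + B + C * t)])
    (z := ![u, v, z]) (by
      intro i _
      fin_cases i <;> simp <;> positivity) (by
      simp [Fin.sum_univ_three]
      field_simp) (by
      intro i _
      fin_cases i
      · exact hu'
      · exact hv'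
      · exact hz)
  rw [Fin.sum_univ_three] at hmem
  have hmem' : (A / (A + B + C * t)) • u + (B / (A + B + C * t)) • v +
      (C * t / (A + B + C * t)) • z ∈ convexHull ℝ ((P : Set Plane) \ {x'}) := by
    simpa using hmem
  rwa [← hxe] at hmem'

/-- Among three collinear points the middle one would lie in the hull of the other two. -/
theorem orient_ne_zero {P : Finset Plane} (hP : InConvexPosition P) {a b c : Plane}
    (ha : a ∈ P) (hb : b ∈ P) (hc : c ∈ P) (hab : a ≠ b) (hac : a ≠ c) (hbc : b ≠ c) :
    orient a b c ≠ 0 := by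
  intro h
  have key : ∀ {x y z : Plane}, x ∈ P → y ∈ P → z ∈ P → y ≠ x → z ≠ x → Wbtw ℝ y x z → False := by
    rintro x y z hx hy hz hyx hzx ⟨t, ⟨ht0, ht1⟩, rfl⟩
    refine false_of_combination hP hx hy hz hyx hzx (subset_convexHull ℝ _ hx)
      (A := 1 - t) (B := t) (C := 0) (by linarith) ht0 le_rfl (by linarith) ?_
    rw [AffineMap.lineMap_apply, vsub_eq_sub, vadd_eq_add]
    module
  have hcol : Collinear ℝ {a, b, c} := by
    rw [collinear_iff_of_mem (p₀ := a) (by simp)]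
    refine ⟨b - a, ?_⟩
    have hne : (b 0 - a 0) ^ 2 + (b 1 - a 1) ^ 2 ≠ 0 := by
      intro h0
      apply hab
      have h1 : b 0 - a 0 = 0 := by nlinarith [sq_nonneg (b 0 - a 0), sq_nonneg (b 1 - a 1)]
      have h2 : b 1 - a 1 = 0 := by nlinarith [sq_nonneg (b 0 - a 0), sq_nonneg (b 1 - a 1)]
      exact plane_ext (by linarith) (by linarith)
    intro q hq
    rcases hq with rfl | rfl | rfl
    · exact ⟨0, by simp⟩
    · exact ⟨1, by simp⟩
    · refine ⟨((b 0 - a 0) * (q 0 - a 0) + (b 1 - a 1) * (q 1 - a 1)) /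
        ((b 0 - a 0) ^ 2 + (b 1 - a 1) ^ 2), plane_ext ?_ ?_⟩
      · simp only [vadd_eq_add, PiLp.add_apply, PiLp.smul_apply, PiLp.sub_apply, smul_eq_mul]
        field_simp
        simp only [orient] at h
        linear_combination (-(b 1 - a 1)) * h
      · simp only [vadd_eq_add, PiLp.add_apply, PiLp.smul_apply, PiLp.sub_apply, smul_eq_mul]
        field_simp
        simp only [orient] at h
        linear_combination (b 0 - a 0) * h
  rcases hcol.wbtw_or_wbtw_or_wbtw with h1 | h1 | h1
  · exact key hb ha hc hab hbc.symm h1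
  · exact key hc hb ha hbc hac h1
  · exact key ha hc hb hac.symm hab.symm h1

/-! ### Angular orders around a point of the convex hull -/

/-- `t` is an admissible polar angle of the point `x` around `c`, as seen from `conv P`. -/
def IsAngle (P : Finset Plane) (c x : Plane) (t : ℝ) : Prop :=
  x = c + dist x c • unitVec t ∧
    (x = c → ∃ r : ℝ, 0 < r ∧ c - r • unitVec t ∈ convexHull ℝ (P : Set Plane))

theorem unitVec_add_two_pi (t : ℝ) : unitVec (t + 2 * Real.pi) = unitVec t := by
  simp [unitVec]

theorem IsAngle.add_two_pi {P : Finset Plane} {c x : Plane} {t : ℝ} (h : IsAngle P c x t) :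
    IsAngle P c x (t + 2 * Real.pi) := by
  rwa [IsAngle, unitVec_add_two_pi]

theorem IsAngle.coord {P : Finset Plane} {c x : Plane} {t : ℝ} (h : IsAngle P c x t) :
    x 0 = c 0 + dist x c * Real.cos t ∧ x 1 = c 1 + dist x c * Real.sin t := by
  constructor
  · have := congrArg (fun z : Plane => z 0) h.1
    simpa [unitVec] using this
  · have := congrArg (fun z : Plane => z 1) h.1
    simpa [unitVec] using this

/-- The triangle is the signed sum of three triangles with apex `c`, so signs can be read off the
sines of the angular gaps. -/
theorem orient_eq_of_isAngle {P : Finset Plane} {c x y z : Plane} {α β γ : ℝ}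
    (hx : IsAngle P c x α) (hy : IsAngle P c y β) (hz : IsAngle P c z γ) :
    orient x y z = dist x c * dist y c * Real.sin (β - α) + dist y c * dist z c * Real.sin (γ - β)
      - dist z c * dist x c * Real.sin (γ - α) := by
  simp only [orient, hx.coord.1, hx.coord.2, hy.coord.1, hy.coord.2, hz.coord.1, hz.coord.2,
    Real.sin_sub]
  ring

/-- The sine rule for three directions. -/
theorem sin_smul_unitVec (α β γ : ℝ) :
    Real.sin (γ - α) • unitVec β =
      Real.sin (γ - β) • unitVec α + Real.sin (β - α) • unitVec γ := by
  apply plane_ext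
  · simp only [unitVec, PiLp.add_apply, PiLp.smul_apply, smul_eq_mul, Real.sin_sub]
    simp
    ring
  · simp only [unitVec, PiLp.add_apply, PiLp.smul_apply, smul_eq_mul, Real.sin_sub]
    simp
    ring

/-- If the orientation were negative, `y` would lie on the same side of the line `xz` as `c`, hence
in the triangle of `x`, `z` and the hull point `c`, against convex position. -/
theorem orient_pos_of_lt_pi {P : Finset Plane} (hP : InConvexPosition P) {c x y z : Plane}
    (hc : c ∈ convexHull ℝ (P : Set Plane)) (hxP : x ∈ P) (hyP : y ∈ P) (hzP : z ∈ P)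
    (hxy : x ≠ y) (hxz : x ≠ z) (hyz : y ≠ z) {α β γ : ℝ} (hx : IsAngle P c x α)
    (hy : IsAngle P c y β) (hz : IsAngle P c z γ) (hαβ : α ≤ β) (hβγ : β ≤ γ)
    (hγ : γ - α < Real.pi) : 0 < orient x y z := by
  by_contra hneg
  have hlt : orient x y z < 0 :=
    lt_of_le_of_ne (not_lt.1 hneg) (orient_ne_zero hP hxP hyP hzP hxy hxz hyz)
  rw [orient_eq_of_isAngle hx hy hz] at hlt
  have s1 : 0 ≤ Real.sin (β - α) := Real.sin_nonneg_of_nonneg_of_le_pi (by linarith) (by linarith)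
  have s2 : 0 ≤ Real.sin (γ - β) := Real.sin_nonneg_of_nonneg_of_le_pi (by linarith) (by linarith)
  have s3 : 0 ≤ Real.sin (γ - α) := Real.sin_nonneg_of_nonneg_of_le_pi (by linarith) (by linarith)
  have hid := sin_smul_unitVec α β γ
  set S1 := Real.sin (β - α)
  set S2 := Real.sin (γ - β)
  set S := Real.sin (γ - α)
  have dx : 0 ≤ dist x c := dist_nonneg
  have dy : 0 ≤ dist y c := dist_nonneg
  have dz : 0 ≤ dist z c := dist_nonneg
  have hpos : 0 < dist z c * dist x c * S := by
    have : 0 ≤ dist x c * dist y c * S1 := by positivity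
    have : 0 ≤ dist y c * dist z c * S2 := by positivity
    linarith
  have hS : 0 < S := by
    rcases s3.eq_or_lt with h | h
    · rw [← h] at hpos; simp at hpos
    · exact h
  have hdx : 0 < dist x c := by
    rcases dx.eq_or_lt with h | h
    · rw [← h] at hpos; simp at hpos
    · exact h
  have hdz : 0 < dist z c := by
    rcases dz.eq_or_lt with h | h
    · rw [← h] at hpos; simp at hpos
    · exact h
  -- The weights on `x` and `z` must not both vanish: otherwise the sine rule would give `unitVec β
  -- = 0`.
  have hS12 : 0 < S2 * dist z c + S1 * dist x c := by
    have h12 : 0 < S1 + S2 := by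
      by_contra hle
      have e1 : S1 = 0 := by linarith
      have e2 : S2 = 0 := by linarith
      rw [e1, e2, zero_smul, zero_smul, add_zero] at hid
      have hu : unitVec β = 0 := (smul_eq_zero.1 hid).resolve_left hS.ne'
      have h0 : Real.cos β = 0 := by simpa [unitVec] using congrArg (fun w : Plane => w 0) hu
      have h1 : Real.sin β = 0 := by simpa [unitVec] using congrArg (fun w : Plane => w 1) hu
      have := Real.sin_sq_add_cos_sq β
      rw [h0, h1] at this
      norm_num at this
    rcases s1.eq_or_lt with h | h
    · have : 0 < S2 := by linarith
      positivity
    · positivity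
  have ex : x - c = dist x c • unitVec α := by
    nth_rewrite 1 [hx.1]
    simp
  have ez : z - c = dist z c • unitVec γ := by
    nth_rewrite 1 [hz.1]
    simp
  have hid' : (S2 * dist z c) • (x - c) + (S1 * dist x c) • (z - c) =
      (dist x c * dist z c * S) • unitVec β := by
    rw [ex, ez, mul_smul (dist x c * dist z c), hid]
    module
  -- When `y` is the centre itself, the point of the hull behind it, guaranteed by the admissible
  -- angle, takes over the role of `c`.
  by_cases hyc : y = c
  · obtain ⟨r, hr, hmem⟩ := hy.2 hyc
    subst hyc
    refine false_of_combination hP hyP hxP hzP hxy hyz.symm hmem (A := S2 * dist z y)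
      (B := S1 * dist x y) (C := dist x y * dist z y * S / r) (by positivity) (by positivity)
      (by positivity) hS12 ?_
    rw [hid', sub_sub_cancel_left, smul_neg, smul_smul, div_mul_cancel₀ _ hr.ne', add_neg_cancel]
  · have hdy : 0 < dist y c := dist_pos.2 hyc
    have ey : y - c = dist y c • unitVec β := by
      nth_rewrite 1 [hy.1]
      simp
    refine false_of_combination hP hyP hxP hzP hxy hyz.symm hc
      (A := dist y c * (S2 * dist z c)) (B := dist y c * (S1 * dist x c))
      (C := dist z c * dist x c * S - dist x c * dist y c * S1 - dist y c * dist z c * S2)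
      (by positivity) (by positivity) (by linarith) ?_ ?_
    · rw [← mul_add]
      positivity
    -- The coefficient `C` is minus the orientation; the required relation is the sine rule scaled
    -- by the three distances.
    · have h1 : (dist x c * dist z c * S) • (y - c) =
          dist y c • ((S2 * dist z c) • (x - c) + (S1 * dist x c) • (z - c)) := by
        rw [hid', ey]
        module
      rw [← sub_eq_zero] at h1
      rw [← neg_eq_zero, ← h1]
      module

/-- Three points in angular order around a point of the hull are positively oriented. -/
theorem orient_pos {P : Finset Plane} (hP : InConvexPosition P) {c x y z : Plane}
    (hc : c ∈ convexHull ℝ (P : Set Plane)) (hxP : x ∈ P) (hyP : y ∈ P) (hzP : z ∈ P)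
    (hxy : x ≠ y) (hxz : x ≠ z) (hyz : y ≠ z) {α β γ : ℝ} (hx : IsAngle P c x α)
    (hy : IsAngle P c y β) (hz : IsAngle P c z γ) (hαβ : α ≤ β) (hβγ : β ≤ γ)
    (hγ : γ < α + 2 * Real.pi) : 0 < orient x y z := by
  -- At most one of the cyclic gaps β - α, γ - β, α + 2π - γ exceeds π. If one does, the points lie
  -- within less than a half-turn, starting right after that gap.
  by_cases h1 : γ - α < Real.pi
  · exact orient_pos_of_lt_pi hP hc hxP hyP hzP hxy hxz hyz hx hy hz hαβ hβγ h1
  by_cases h2 : Real.pi < β - α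
  · rw [← orient_rotate]
    exact orient_pos_of_lt_pi hP hc hyP hzP hxP hyz hxy.symm hxz.symm hy hz hx.add_two_pi hβγ
      hγ.le (by linarith)
  by_cases h3 : Real.pi < γ - β
  · rw [← orient_rotate, ← orient_rotate]
    exact orient_pos_of_lt_pi hP hc hzP hxP hyP hxz.symm hyz.symm hxy hz hx.add_two_pi
      hy.add_two_pi hγ.le (by linarith) (by linarith)
  -- No gap exceeds π, so all three signed areas at `c` are nonnegative.
  refine lt_of_le_of_ne ?_ (orient_ne_zero hP hxP hyP hzP hxy hxz hyz).symm
  rw [orient_eq_of_isAngle hx hy hz]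
  have s1 : 0 ≤ Real.sin (β - α) := Real.sin_nonneg_of_nonneg_of_le_pi (by linarith) (by linarith)
  have s2 : 0 ≤ Real.sin (γ - β) := Real.sin_nonneg_of_nonneg_of_le_pi (by linarith) (by linarith)
  have s3 : Real.sin (γ - α) ≤ 0 := by
    have := Real.sin_nonneg_of_nonneg_of_le_pi (x := γ - α - Real.pi) (by linarith) (by linarith)
    rw [Real.sin_sub_pi] at this
    linarith
  have : 0 ≤ dist z c * dist x c * (-Real.sin (γ - α)) := by
    have : 0 ≤ -Real.sin (γ - α) := by linarith
    positivity
  have : 0 ≤ dist x c * dist y c * Real.sin (β - α) := by positivity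
  have : 0 ≤ dist y c * dist z c * Real.sin (γ - β) := by positivity
  linarith

/-- Three points in cyclic order are positively oriented. -/
def PositivelyOriented {n : ℕ} (p : ZMod n → Plane) : Prop :=
  ∀ i j k : ℕ, i < j → j < k → k < n → 0 < orient (p i) (p j) (p k)

theorem IsAngularOrder.positivelyOriented {P : Finset Plane} (hP : InConvexPosition P)
    {c : Plane} (hc : c ∈ convexHull ℝ (P : Set Plane)) {p : ZMod P.card → Plane}
    (hp : IsAngularOrder P c p) : PositivelyOriented p := by
  obtain ⟨⟨hinj, hrange⟩, θ, hmono, hlt, hpol, hcen⟩ := hp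
  have hmem : ∀ i, p i ∈ P := fun i => by
    have : p i ∈ Set.range p := ⟨i, rfl⟩
    rw [hrange] at this
    exact_mod_cast this
  have hne : ∀ i j : ℕ, i < j → j < P.card → p i ≠ p j := by
    intro i j hij hj h
    have h := congrArg ZMod.val (hinj h)
    rw [ZMod.val_natCast_of_lt hj, ZMod.val_natCast_of_lt (hij.trans hj)] at h
    omega
  have hang : ∀ i : ℕ, i < P.card → IsAngle P c (p i) (θ i) := fun i hi => ⟨hpol i hi, hcen i hi⟩
  intro i j k hij hjk hk
  have hj := hjk.trans hk
  have hi := hij.trans hj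
  refine orient_pos hP hc (hmem _) (hmem _) (hmem _) (hne i j hij hj) (hne i k (hij.trans hjk) hk)
    (hne j k hjk hk) (hang i hi) (hang j hj) (hang k hk) (hmono i j hij.le hj)
    (hmono j k hjk.le hk) ?_
  have h0 := hmono 0 i (Nat.zero_le _) hi
  have h1 := hlt k hk
  linarith

/-- In the convex quadrilateral a, a+1, b, b+1 this is the excess of the diagonals over two opposite
sides. For adjacent gaps it degenerates to a strict triangle inequality. -/
theorem crossDiff_pos_of_val_lt {n : ℕ} [NeZero n] (hn : 2 < n) {p : ZMod n → Plane}
    (hp : PositivelyOriented p) {a b : ZMod n} (hab : a.val < b.val) :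
    0 < crossDiff (fun i j => dist (p i) (p j)) a b := by
  obtain ⟨i, hi, rfl⟩ : ∃ i : ℕ, i < n ∧ (i : ZMod n) = a := ⟨a.val, ZMod.val_lt a, by simp⟩
  obtain ⟨j, hj, rfl⟩ : ∃ j : ℕ, j < n ∧ (j : ZMod n) = b := ⟨b.val, ZMod.val_lt b, by simp⟩
  rw [ZMod.val_natCast_of_lt hi, ZMod.val_natCast_of_lt hj] at hab
  have hcast : ∀ k : ℕ, ((k : ZMod n) + 1) = ((k + 1 : ℕ) : ZMod n) := fun k => by push_cast; rfl
  simp only [crossDiff, hcast]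
  by_cases hj1 : j + 1 < n
  · by_cases hij : i + 1 = j
    · subst hij
      have := dist_lt_of_orient_ne_zero (hp i (i + 1) (i + 1 + 1) (by omega) (by omega) hj1).ne'
      rw [dist_self]
      linarith
    · have := dist_add_dist_lt_of_orient (hp i (i + 1) j (by omega) (by omega) hj)
        (hp i (i + 1) (j + 1) (by omega) (by omega) hj1)
        (hp i j (j + 1) (by omega) (by omega) hj1)
        (hp (i + 1) j (j + 1) (by omega) (by omega) hj1)
      linarith
  -- Now b + 1 wraps to index 0, so the gaps may also be adjacent across 0; orientations are rotated
  -- to list index 0 first.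
  · have hjn : j + 1 = n := by omega
    have hj0 : ((j + 1 : ℕ) : ZMod n) = ((0 : ℕ) : ZMod n) := by
      rw [hjn]
      simp
    rw [hj0]
    by_cases hij : i + 1 = j
    · subst hij
      have := dist_lt_of_orient_ne_zero (a := p (i : ℕ)) (b := p (i + 1 : ℕ)) (c := p (0 : ℕ))
        (by rw [orient_rotate]; exact (hp 0 i (i + 1) (by omega) (by omega) hj).ne')
      rw [dist_self]
      linarith
    by_cases hi0 : i = 0
    · subst hi0
      have := dist_lt_of_orient_ne_zero (a := p (j : ℕ)) (b := p (0 : ℕ)) (c := p (0 + 1 : ℕ))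
        (by rw [orient_rotate, orient_rotate]; exact (hp 0 (0 + 1) j (by omega) (by omega) hj).ne')
      rw [dist_self, dist_comm (p (0 : ℕ)) (p (j : ℕ)), dist_comm (p (0 + 1 : ℕ)) (p (0 : ℕ)),
        dist_comm (p (0 + 1 : ℕ)) (p (j : ℕ))]
      linarith
    · have := dist_add_dist_lt_of_orient (hp i (i + 1) j (by omega) (by omega) hj)
        (d := p (0 : ℕ))
        (by rw [orient_rotate]; exact hp 0 i (i + 1) (by omega) (by omega) (by omega))
        (by rw [orient_rotate]; exact hp 0 i j (by omega) (by omega) (by omega))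
        (by rw [orient_rotate]; exact hp 0 (i + 1) j (by omega) (by omega) (by omega))
      linarith

theorem crossDiff_comm {n : ℕ} (d : ZMod n → ZMod n → ℝ) (hd : ∀ x y, d x y = d y x)
    (a b : ZMod n) : crossDiff d a b = crossDiff d b a := by
  simp only [crossDiff]
  rw [hd a b, hd (a + 1) (b + 1), hd a (b + 1), hd (a + 1) b]
  ring

theorem crossDiff_pos {n : ℕ} [NeZero n] (hn : 2 < n) {p : ZMod n → Plane}
    (hp : PositivelyOriented p) {a b : ZMod n} (hab : a ≠ b) :
    0 < crossDiff (fun i j => dist (p i) (p j)) a b := by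
  rcases lt_trichotomy a.val b.val with h | h | h
  · exact crossDiff_pos_of_val_lt hn hp h
  · exact absurd (ZMod.val_injective n h) hab
  · rw [crossDiff_comm _ fun x y => dist_comm _ _]
    exact crossDiff_pos_of_val_lt hn hp h

/-! ### Tours in terms of a given enumeration -/

theorem isTour_iff {P : Finset Plane} [NeZero P.card] {p : ZMod P.card → Plane}
    (hp : Enumerates P p) {T : Finset (Sym2 Plane)} :
    IsTour P T ↔ ∃ τ : ZMod P.card → ZMod P.card,
      Function.Bijective τ ∧ T = connectAll (p ∘ τ) 1 := by
  constructor
  · rintro ⟨q, ⟨hq, hqr⟩, rfl⟩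
    have hex : ∀ k, ∃ i, p i = q k := fun k => by
      have : q k ∈ Set.range q := ⟨k, rfl⟩
      rwa [hqr, ← hp.2] at this
    choose τ hτ using hex
    refine ⟨τ, Finite.injective_iff_bijective.1 fun i j hij => hq ?_, ?_⟩
    · rw [← hτ, ← hτ, hij]
    · congr 1
      exact funext fun k => (hτ k).symm
  · rintro ⟨τ, hτ, rfl⟩
    exact ⟨p ∘ τ, ⟨hp.1.comp hτ.1, by rw [hτ.2.range_comp, hp.2]⟩, rfl⟩

/-- A tour has exactly n distinct edges, so it fills any set of at most n edges that contains it. -/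
theorem connectAll_one_eq_of_forall_mem {n : ℕ} [NeZero n] (hn : 2 < n) {q : ZMod n → Plane}
    (hq : Function.Injective q) {T : Finset (Sym2 Plane)} (hT : T.card ≤ n)
    (h : ∀ k, s(q k, q (k + 1)) ∈ T) : connectAll q 1 = T := by
  refine Finset.eq_of_subset_of_card_le (fun e he => ?_) (by rwa [card_connectAll_one hn hq])
  obtain ⟨i, rfl⟩ := mem_connectAll.1 he
  simpa using h i

/-! ### The odd case -/

section Odd

variable {n : ℕ} [NeZero n]

/-- Modulo 2u + 1 the inverse of u is -2. Hence the near-diagonals form a single cycle. -/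
theorem natCast_bijective_mul {u : ℕ} (hn : n = 2 * u + 1) :
    Function.Bijective fun k : ZMod n => k * (u : ZMod n) := by
  refine Finite.injective_iff_bijective.1 fun i j hij => ?_
  have h0 : ((2 * u + 1 : ℕ) : ZMod n) = 0 := by
    rw [← hn]
    simp
  push_cast at h0
  have hij : i * (u : ZMod n) = j * (u : ZMod n) := hij
  linear_combination (-2 : ZMod n) * hij + (i - j) * h0

/-- The endpoints of a chord of step `u ≤ n / 2` do not lie on a common arc of at most `u`
points. -/
theorem not_inArc_and_inArc {u : ℕ} (hu : 0 < u) (hun : 2 * u ≤ n) (a b x : ZMod n) :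
    (a.val ≤ b.val + u ∧ b.val ≤ a.val + u → ¬ (InArc a b x ∧ InArc a b (x + (u : ZMod n)))) ∧
    (a.val + n ≤ b.val + u ∨ b.val + n ≤ a.val + u →
      ¬ (¬ InArc a b x ∧ ¬ InArc a b (x + (u : ZMod n)))) := by
  have h := val_add_natCast x (u := u) (by omega)
  have hx := ZMod.val_lt x
  have ha := ZMod.val_lt a
  have hb := ZMod.val_lt b
  simp only [InArc]
  generalize (x + (u : ZMod n)).val = y at *
  split_ifs at h <;> omega

/-- If y - x is neither u nor u + 1, one of the two closed arcs between `x` and `y` has at most u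
points. -/
theorem exists_arc_of_not_chord_of_lt {u : ℕ} (hu : 0 < u) (hn : n = 2 * u + 1) {x y : ZMod n}
    (hxy : x.val < y.val) (h1 : y ≠ x + (u : ZMod n)) (h2 : x ≠ y + (u : ZMod n)) :
    ∃ a b : ZMod n, (a.val ≤ b.val + u ∧ b.val ≤ a.val + u ∧ InArc a b x ∧ InArc a b y) ∨
      ((a.val + n ≤ b.val + u ∨ b.val + n ≤ a.val + u) ∧ ¬ InArc a b x ∧ ¬ InArc a b y) := by
  have hx := ZMod.val_lt x
  have hy := ZMod.val_lt y
  have h1' : y.val ≠ x.val + u := by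
    intro h
    apply h1
    apply ZMod.val_injective
    rw [val_add_natCast x (by omega), if_pos (by omega), h]
  have h2' : y.val ≠ x.val + u + 1 := by
    intro h
    apply h2
    apply ZMod.val_injective
    rw [val_add_natCast y (by omega), if_neg (by omega)]
    omega
  have cast : ∀ k, k < n → ∃ a : ZMod n, a.val = k := fun k hk => ⟨k, ZMod.val_natCast_of_lt hk⟩
  simp only [InArc]
  by_cases hlt : y.val < x.val + u
  -- `InArc` never holds at index 0. A short arc starting at 0 is therefore the outside of the gaps
  -- after `y` and after n - 1.
  · by_cases hx0 : x.val = 0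
    · obtain ⟨a, ha⟩ := cast (n - 1) (by omega)
      exact ⟨y, a, Or.inr (by omega)⟩
    · obtain ⟨a, ha⟩ := cast (x.val - 1) (by omega)
      exact ⟨a, y, Or.inl (by omega)⟩
  · obtain ⟨b, hb⟩ := cast (y.val - 1) (by omega)
    exact ⟨x, b, Or.inr (by omega)⟩

theorem exists_arc_of_not_chord {u : ℕ} (hu : 0 < u) (hn : n = 2 * u + 1) {x y : ZMod n}
    (hxy : x ≠ y) (h1 : y ≠ x + (u : ZMod n)) (h2 : x ≠ y + (u : ZMod n)) :
    ∃ a b : ZMod n, (a.val ≤ b.val + u ∧ b.val ≤ a.val + u ∧ InArc a b x ∧ InArc a b y) ∨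
      ((a.val + n ≤ b.val + u ∨ b.val + n ≤ a.val + u) ∧ ¬ InArc a b x ∧ ¬ InArc a b y) := by
  rcases lt_trichotomy x.val y.val with h | h | h
  · exact exists_arc_of_not_chord_of_lt hu hn h h1 h2
  · exact absurd (ZMod.val_injective n h) hxy
  · obtain ⟨a, b, hab⟩ := exists_arc_of_not_chord_of_lt hu hn h h2 h1
    exact ⟨a, b, by tauto⟩

/-- For odd `n` the near-diagonals form a tour, which is the unique longest one. -/
theorem nearDiagonals_optimal {u : ℕ} (hu : 0 < u) (hn : n = 2 * u + 1) {p : ZMod n → Plane}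
    (hp : Function.Injective p)
    (hW : ∀ a b, a ≠ b → 0 < crossDiff (fun i j => dist (p i) (p j)) a b) :
    ∃ τ : ZMod n → ZMod n, Function.Bijective τ ∧ connectAll (p ∘ τ) 1 = connectAll p u ∧
      ∀ σ : ZMod n → ZMod n, Function.Bijective σ →
        totalLength (connectAll (p ∘ σ) 1) ≤ totalLength (connectAll p u) ∧
        (totalLength (connectAll (p ∘ σ) 1) = totalLength (connectAll p u) →
          connectAll (p ∘ σ) 1 = connectAll p u) := by
  have hn2 : 2 < n := by omega
  have hτ := natCast_bijective_mul hn
  set τ : ZMod n → ZMod n := fun k => k * (u : ZMod n) with hτdef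
  have hstep : ∀ k, τ (k + 1) = τ k + (u : ZMod n) := fun k => by
    simp only [hτdef]
    ring
  have hin : ∀ a b : ZMod n, a.val ≤ b.val + u ∧ b.val ≤ a.val + u →
      ∀ k, ¬ (InArc a b (τ k) ∧ InArc a b (τ (k + 1))) := fun a b hab k => by
    rw [hstep]
    exact (not_inArc_and_inArc hu (by omega) a b _).1 hab
  have hout : ∀ a b : ZMod n, a.val + n ≤ b.val + u ∨ b.val + n ≤ a.val + u →
      ∀ k, ¬ (¬ InArc a b (τ k) ∧ ¬ InArc a b (τ (k + 1))) := fun a b hab k => by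
    rw [hstep]
    exact (not_inArc_and_inArc hu (by omega) a b _).2 hab
  have hT : connectAll (p ∘ τ) 1 = connectAll p u := by
    refine connectAll_one_eq_of_forall_mem hn2 (hp.comp hτ.1) (card_connectAll_le p u) fun k => ?_
    exact mem_connectAll.2 ⟨τ k, by simp only [Function.comp, hstep]⟩
  refine ⟨τ, hτ, hT, fun σ hσ => ?_⟩
  have hcut : ∀ a b, a ≠ b → cut σ a b ≤ cut τ a b := by
    intro a b _
    have ha := ZMod.val_lt a
    have hb := ZMod.val_lt b
    apply cut_le_cut hτ hσ
    -- As n = 2u + 1, either the arc or its complement has at most u points.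
    by_cases hab : a.val ≤ b.val + u ∧ b.val ≤ a.val + u
    · exact Or.inl (hin a b hab)
    · exact Or.inr (hout a b (by omega))
  have hd : ∀ x y, dist (p x) (p y) = dist (p y) (p x) := fun x y => dist_comm _ _
  have hd0 : ∀ x, dist (p x) (p x) = 0 := fun x => dist_self _
  rw [← hT, totalLength_connectAll_one hn2 (hp.comp hσ.1),
    totalLength_connectAll_one hn2 (hp.comp hτ.1)]
  refine ⟨sum_le_sum_of_cut (by omega) hd hd0 hW hcut, fun heq => ?_⟩
  rw [hT]
  refine connectAll_one_eq_of_forall_mem hn2 (hp.comp hσ.1) (card_connectAll_le p u) fun k => ?_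
  rw [mem_connectAll]
  by_contra hne
  push Not at hne
  have hkk : σ k ≠ σ (k + 1) := by
    intro h
    have h := hσ.1 h
    have : (1 : ZMod n) = 0 := by linear_combination -h
    have h1 : ((1 : ℕ) : ZMod n) = 0 := by exact_mod_cast this
    rw [ZMod.natCast_eq_zero_iff] at h1
    exact absurd (Nat.le_of_dvd one_pos h1) (by omega)
  obtain ⟨a, b, hab⟩ := exists_arc_of_not_chord hu hn hkk
    (fun h => hne (σ k) (by simp only [Function.comp, h]))
    (fun h => hne (σ (k + 1)) (by rw [← h]; exact Sym2.eq_swap))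
  have hlt : cut σ a b < cut τ a b := by
    apply cut_lt_cut hτ hσ
    rcases hab with ⟨h1, h2, h3⟩ | ⟨h1, h2⟩
    · exact Or.inl ⟨hin a b ⟨h1, h2⟩, k, h3⟩
    · exact Or.inr ⟨hout a b h1, k, h2⟩
  exact (sum_lt_sum_of_cut (by omega) hd hd0 hW hcut hlt).ne heq

end Odd

/-! ### The even case -/

section Arcs

variable {n : ℕ}

theorem inArc_iff {a b x : ZMod n} :
    InArc a b x ↔ a.val < x.val ∧ x.val ≤ b.val ∨ b.val < x.val ∧ x.val ≤ a.val := by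
  unfold InArc
  omega

theorem separates_iff {a b x y : ZMod n} :
    Separates a b x y ↔ InArc a b x ∧ ¬ InArc a b y ∨ ¬ InArc a b x ∧ InArc a b y := by
  unfold Separates
  tauto

theorem inArc_comm {a b x : ZMod n} : InArc a b x ↔ InArc b a x := by
  rw [inArc_iff, inArc_iff, or_comm]

open Classical in
theorem cut_comm [NeZero n] (τ : ZMod n → ZMod n) (a b : ZMod n) : cut τ a b = cut τ b a := by
  have h : ∀ x y, Separates a b x y ↔ Separates b a x y := fun x y => by
    rw [separates_iff, separates_iff, inArc_comm, inArc_comm (a := a) (x := y)]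
  exact congrArg Finset.card (Finset.filter_congr fun k _ => h (τ k) (τ (k + 1)))

end Arcs

/-! ### The exchanged tour and the halving arcs -/

section Even

variable {n : ℕ} [NeZero n]

/-- The edges (as pairs of indices below `2 * m`) of the tour obtained from the near-diagonals
by the exchange at `0`. -/
def ExchangedEdge (m x y : ℕ) : Prop :=
  ((y = x + (m - 1) ∨ x = y + (m - 1) ∨ y = x + (m + 1) ∨ x = y + (m + 1)) ∧
    ¬ (x = 0 ∧ y = m + 1) ∧ ¬ (x = m + 1 ∧ y = 0) ∧ ¬ (x = 1 ∧ y = m) ∧ ¬ (x = m ∧ y = 1)) ∨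
  (x = 0 ∧ y = m) ∨ (x = m ∧ y = 0) ∨ (x = 1 ∧ y = m + 1) ∨ (x = m + 1 ∧ y = 1)

theorem sym2_eq_iff_val {p : ZMod n → Plane} (hp : Function.Injective p) (x y u v : ZMod n) :
    s(p x, p y) = s(p u, p v) ↔
      (x.val = u.val ∧ y.val = v.val) ∨ (x.val = v.val ∧ y.val = u.val) := by
  simp only [Sym2.eq_iff, hp.eq_iff, (ZMod.val_injective n).eq_iff]

theorem mem_exchange_zero_iff {m : ℕ} (hm : 2 ≤ m) (hn : n = 2 * m) {p : ZMod n → Plane}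
    (hp : Function.Injective p) (x y : ZMod n) :
    s(p x, p y) ∈ exchange p 0 (connectAll p (n / 2 - 1)) ↔ ExchangedEdge m x.val y.val := by
  have hdiv : n / 2 = m := by omega
  have hx := ZMod.val_lt x
  have hy := ZMod.val_lt y
  have v0 : (0 : ZMod n).val = 0 := ZMod.val_zero
  have vm : ((0 : ZMod n) + (m : ℕ)).val = m := by
    rw [zero_add, ZMod.val_natCast_of_lt (by omega)]
  have vm1 : ((0 : ZMod n) + (m : ℕ) + 1).val = m + 1 := by
    rw [val_add_one' (by omega), vm, if_pos (by omega)]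
  have v1 : ((0 : ZMod n) + 1).val = 1 := by
    rw [val_add_one' (by omega), v0, if_pos (by omega)]
  have v1m : ((0 : ZMod n) + 1 + (m : ℕ)).val = m + 1 := by
    rw [val_add_natCast _ (by omega), v1, if_pos (by omega), add_comm]
  -- A step of m - 1 modulo 2m shows as a difference m - 1 of representatives, or m + 1 after
  -- wrapping.
  have hnear : s(p x, p y) ∈ connectAll p (m - 1) ↔
      y.val = x.val + (m - 1) ∨ x.val = y.val + (m - 1) ∨ y.val = x.val + (m + 1) ∨
        x.val = y.val + (m + 1) := by
    have hvx := val_add_natCast x (u := m - 1) (by omega)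
    have hvy := val_add_natCast y (u := m - 1) (by omega)
    have : s(p x, p y) ∈ connectAll p (m - 1) ↔
        y.val = (x + ((m - 1 : ℕ) : ZMod n)).val ∨ x.val = (y + ((m - 1 : ℕ) : ZMod n)).val := by
      rw [mem_connectAll]
      constructor
      · rintro ⟨j, hj⟩
        rw [sym2_eq_iff_val hp] at hj
        rcases hj with ⟨h1, h2⟩ | ⟨h1, h2⟩
        · rw [← h2, ZMod.val_injective n h1]
          exact Or.inl rfl
        · rw [← h2, ZMod.val_injective n h1]
          exact Or.inr rfl
      · rintro (h | h)
        · exact ⟨x, by rw [ZMod.val_injective n h]⟩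
        · exact ⟨y, by rw [ZMod.val_injective n h]; exact Sym2.eq_swap⟩
    rw [this, hvx, hvy]
    split_ifs <;> omega
  simp only [exchange, hdiv, Finset.mem_union, Finset.mem_sdiff, Finset.mem_insert,
    Finset.mem_singleton, hnear, sym2_eq_iff_val hp, v0, vm, vm1, v1, v1m, ExchangedEdge,
    not_or, or_assoc]

/-- The order in which the exchanged tour visits the indices. -/
def exchangedOrder (m u : ℕ) : ℕ :=
  -- The first half runs m, 2m-1, m-2, 2m-3, … and the second half runs upwards, ending at 0. The
  -- halves are joined by the diagonals {1, m+1} and {0, m}.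
  if u < m then (if u % 2 = 0 then m - u else 2 * m - u)
  else if u % 2 = 0 then u + 1 - m
  else if u + 1 < 2 * m then u + 1 else 0

theorem exchangedOrder_lt {m u : ℕ} (hm : 2 ≤ m) (hu : u < 2 * m) :
    exchangedOrder m u < 2 * m := by
  unfold exchangedOrder
  split_ifs <;> omega

theorem exchangedOrder_inj {m u v : ℕ} (hm : 2 ≤ m) (hu : u < 2 * m) (hv : v < 2 * m)
    (h : exchangedOrder m u = exchangedOrder m v) : u = v := by
  unfold exchangedOrder at h
  split_ifs at h <;> omega

theorem exchangedEdge_exchangedOrder {m u : ℕ} (hm : 2 ≤ m) (hu : u < 2 * m) :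
    ExchangedEdge m (exchangedOrder m u)
      (exchangedOrder m (if u + 1 < 2 * m then u + 1 else 0)) := by
  unfold exchangedOrder ExchangedEdge
  split_ifs <;> omega

theorem exists_exchanged_tour {m : ℕ} (hm : 2 ≤ m) (hn : n = 2 * m) {p : ZMod n → Plane}
    (hp : Function.Injective p) :
    ∃ τ : ZMod n → ZMod n, Function.Bijective τ ∧
      (∀ k, ExchangedEdge m (τ k).val (τ (k + 1)).val) ∧
      connectAll (p ∘ τ) 1 = exchange p 0 (connectAll p (n / 2 - 1)) := by
  classical
  set τ : ZMod n → ZMod n := fun k => (exchangedOrder m k.val : ℕ) with hτdef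
  have hlt : ∀ k : ZMod n, k.val < 2 * m := fun k => hn ▸ ZMod.val_lt k
  have hval : ∀ k, (τ k).val = exchangedOrder m k.val := fun k => by
    have := exchangedOrder_lt hm (hlt k)
    exact ZMod.val_natCast_of_lt (by omega)
  have hτ : Function.Bijective τ := by
    refine Finite.injective_iff_bijective.1 fun i j hij => ?_
    have h := congrArg ZMod.val hij
    rw [hval, hval] at h
    exact ZMod.val_injective n (exchangedOrder_inj hm (hlt i) (hlt j) h)
  have hedge : ∀ k, ExchangedEdge m (τ k).val (τ (k + 1)).val := fun k => by
    have h := exchangedEdge_exchangedOrder hm (hlt k)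
    rw [← hn] at h
    rwa [hval, hval, val_add_one' (by omega)]
  refine ⟨τ, hτ, hedge, ?_⟩
  refine connectAll_one_eq_of_forall_mem (by omega) (hp.comp hτ.1) ?_ fun k =>
    (mem_exchange_zero_iff hm hn hp _ _).2 (hedge k)
  have hdiv : n / 2 = m := by omega
  have v0 : (0 : ZMod n).val = 0 := ZMod.val_zero
  have v1 : ((0 : ZMod n) + 1).val = 1 := by
    rw [val_add_one' (by omega), v0, if_pos (by omega)]
  have hcast : ((m - 1 : ℕ) : ZMod n) = (m : ℕ) - 1 := by
    rw [Nat.cast_sub (by omega), Nat.cast_one]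
  have hn0 : (m : ZMod n) + m = 0 := by
    have : ((2 * m : ℕ) : ZMod n) = 0 := by
      rw [← hn]
      simp
    push_cast at this
    linear_combination this
  -- The two removed edges are present and distinct, so removing them and adding two leaves at most
  -- n edges.
  have hA : s(p 0, p (0 + (n / 2 : ℕ) + 1)) ∈ connectAll p (n / 2 - 1) := by
    rw [mem_connectAll, hdiv]
    refine ⟨0 + (m : ℕ) + 1, ?_⟩
    have h : (0 : ZMod n) + (m : ℕ) + 1 + ((m - 1 : ℕ) : ZMod n) = 0 := by
      rw [hcast]
      linear_combination hn0
    rw [Sym2.eq_swap, h]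
  have hB : s(p (0 + 1), p (0 + (n / 2 : ℕ))) ∈ connectAll p (n / 2 - 1) := by
    rw [mem_connectAll, hdiv]
    refine ⟨0 + 1, ?_⟩
    have h : (0 : ZMod n) + 1 + ((m - 1 : ℕ) : ZMod n) = 0 + (m : ℕ) := by
      rw [hcast]
      ring
    rw [h]
  have hAB : s(p 0, p (0 + (n / 2 : ℕ) + 1)) ≠ s(p (0 + 1), p (0 + (n / 2 : ℕ))) := by
    rw [Ne, sym2_eq_iff_val hp, v0, v1, hdiv]
    have vm : ((0 : ZMod n) + (m : ℕ)).val = m := by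
      rw [zero_add, ZMod.val_natCast_of_lt (by omega)]
    rw [vm]
    omega
  have h1 : ({s(p 0, p (0 + (n / 2 : ℕ) + 1)), s(p (0 + 1), p (0 + (n / 2 : ℕ)))} :
      Finset (Sym2 Plane)) ⊆ connectAll p (n / 2 - 1) := by
    intro e he
    rcases Finset.mem_insert.1 he with rfl | he
    · exact hA
    · rw [Finset.mem_singleton.1 he]
      exact hB
  have h2 := Finset.card_sdiff_of_subset h1
  rw [Finset.card_pair hAB] at h2
  have h3 := card_connectAll_le p (n / 2 - 1)
  have h4 := Finset.card_le_card h1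
  rw [Finset.card_pair hAB] at h4
  refine (Finset.card_union_le _ _).trans ?_
  have h5 := Finset.card_le_two (a := s(p 0, p (0 + (n / 2 : ℕ))))
    (b := s(p (0 + 1), p (0 + 1 + (n / 2 : ℕ))))
  convert add_le_add (h2.le.trans (Nat.sub_le_sub_right h3 2)) h5 using 1
  omega

/-- Every edge joins points at cyclic distance at least m - 1, too far apart for a side with fewer
than m points. -/
theorem exchangedEdge_not_same_side {m : ℕ} (hm : 2 ≤ m) (hn : n = 2 * m) {a b x y : ZMod n}
    (h : ExchangedEdge m x.val y.val) :
    (a.val < b.val + m ∧ b.val < a.val + m → ¬ (InArc a b x ∧ InArc a b y)) ∧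
    (a.val + m < b.val ∨ b.val + m < a.val → ¬ (¬ InArc a b x ∧ ¬ InArc a b y)) := by
  have ha := ZMod.val_lt a
  have hb := ZMod.val_lt b
  have hx := ZMod.val_lt x
  have hy := ZMod.val_lt y
  simp only [InArc, ExchangedEdge] at *
  omega

/-- The only near-diagonals not crossing between 1, …, m and the rest are {1, m} and {0, m+1},
precisely those exchanged for crossing diagonals. -/
theorem exchangedEdge_separates {m : ℕ} (hm : 2 ≤ m) (hn : n = 2 * m) {a b x y : ZMod n}
    (h : ExchangedEdge m x.val y.val)
    (hab : a.val = 0 ∧ b.val = m ∨ a.val = m ∧ b.val = 0) : Separates a b x y := by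
  have hx := ZMod.val_lt x
  have hy := ZMod.val_lt y
  rw [separates_iff, inArc_iff, inArc_iff]
  unfold ExchangedEdge at h
  rcases hab with ⟨ha, hb⟩ | ⟨ha, hb⟩ <;> rcases h with ⟨h | h | h | h, _⟩ | h | h | h | h <;>
    omega

theorem exchangedEdge_inside {m a x y : ℕ} (hm : 2 ≤ m) (h : ExchangedEdge m x y)
    (hx : a < x ∧ x ≤ a + m) (hy : a < y ∧ y ≤ a + m) :
    x = a + 1 ∧ y = a + m ∨ x = a + m ∧ y = a + 1 := by
  rcases h with ⟨h | h | h | h, _⟩ | h | h | h | h <;> omega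

theorem exchangedEdge_outside {m a b x y : ℕ} (hm : 2 ≤ m) (ha : a < m)
    (h : ExchangedEdge m x y) (hx : x < 2 * m) (hy : y < 2 * m) (hx' : ¬ (a < x ∧ x ≤ a + m))
    (hy' : ¬ (a < y ∧ y ≤ a + m)) (hb : b = if a + m + 1 < 2 * m then a + m + 1 else 0) :
    x = b ∧ y = a ∨ x = a ∧ y = b := by
  split_ifs at hb <;> rcases h with ⟨h | h | h | h, _⟩ | h | h | h | h <;> omega

/-- Within a run of m consecutive points, only the two end points are at distance m - 1. So each
half has a single candidate for an uncrossed edge. -/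
theorem exchangedEdge_of_not_separates {m : ℕ} (hm : 2 ≤ m) (hn : n = 2 * m) {a b x y : ZMod n}
    (h : ExchangedEdge m x.val y.val) (hab : b.val = a.val + m)
    (hs : ¬ Separates a b x y) : s(x, y) = s(a + 1, b) ∨ s(x, y) = s(b + 1, a) := by
  have hb := ZMod.val_lt b
  have hx := ZMod.val_lt x
  have hy := ZMod.val_lt y
  have ha1 := val_add_one' (by omega) a
  have hb1 := val_add_one' (by omega) b
  have hin : ∀ z, InArc a b z ↔ a.val < z.val ∧ z.val ≤ a.val + m := fun z => by
    rw [inArc_iff, hab]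
    omega
  rw [if_pos (by omega)] at ha1
  rw [hab] at hb1
  simp only [Sym2.eq_iff, ← (ZMod.val_injective n).eq_iff, ha1, hab]
  by_cases hx' : InArc a b x <;> by_cases hy' : InArc a b y
  · exact Or.inl (exchangedEdge_inside hm h ((hin x).1 hx') ((hin y).1 hy'))
  · exact absurd (separates_iff.2 (Or.inl ⟨hx', hy'⟩)) hs
  · exact absurd (separates_iff.2 (Or.inr ⟨hx', hy'⟩)) hs
  · rw [hin] at hx' hy'
    exact Or.inr (exchangedEdge_outside hm (by omega) h (by omega) (by omega) hx' hy'
      (hb1.trans (if_congr (by omega) rfl rfl)))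

theorem iff_iff_iff_of_not_iff {p p' q q' : Prop} (hp : ¬ (p ↔ p')) (hq : ¬ (q ↔ q')) :
    (p ↔ q) ↔ (p' ↔ q') := by
  tauto

theorem le_cut_add_two {m : ℕ} (hm : 2 ≤ m) (hn : n = 2 * m) {τ : ZMod n → ZMod n}
    (hτ : Function.Bijective τ) (h : ∀ k, ExchangedEdge m (τ k).val (τ (k + 1)).val)
    {a b : ZMod n} (hab : a.val = b.val + m ∨ b.val = a.val + m) : n ≤ cut τ a b + 2 := by
  classical
  wlog hlt : b.val = a.val + m generalizing a b
  · rw [cut_comm]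
    exact this hab.symm (by omega)
  have hsum := Finset.card_filter_add_card_filter_not
    (s := (Finset.univ : Finset (ZMod n))) fun k => Separates a b (τ k) (τ (k + 1))
  rw [Finset.card_univ, ZMod.card] at hsum
  have hle : (Finset.univ.filter fun k => ¬ Separates a b (τ k) (τ (k + 1))).card ≤
      ({s(a + 1, b), s(b + 1, a)} : Finset (Sym2 (ZMod n))).card := by
    refine Finset.card_le_card_of_injOn (fun k => s(τ k, τ (k + 1))) (fun k hk => ?_)
      (edge_injective (by omega) hτ.1).injOn
    have hk' := (Finset.mem_filter.1 hk).2
    simpa using exchangedEdge_of_not_separates hm hn (h k) hlt hk'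
  have h2 := hle.trans Finset.card_le_two
  have h3 : cut τ a b = (Finset.univ.filter fun k => Separates a b (τ k) (τ (k + 1))).card := by
    rw [cut]
  omega

/-- Two different halving arcs cannot both be crossed by all edges of a tour. -/
theorem eq_of_cut_eq {m : ℕ} (hn : n = 2 * m) {σ : ZMod n → ZMod n}
    (hσ : Function.Bijective σ) {a b c d : ZMod n} (hab : b.val = a.val + m)
    (hcd : d.val = c.val + m) (h1 : cut σ a b = n) (h2 : cut σ c d = n) : ¬ a.val < c.val := by
  intro hac
  rw [cut_eq_iff] at h1 h2
  -- An edge crossing both arcs preserves whether its ends have equal membership in the two arcs.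
  -- Along the tour this becomes constant, but a + 1 and c + 1 disagree.
  have hstep : ∀ k, (InArc a b (σ k) ↔ InArc c d (σ k)) ↔
      (InArc a b (σ (k + 1)) ↔ InArc c d (σ (k + 1))) := by
    intro k
    exact iff_iff_iff_of_not_iff (h1 k) (h2 k)
  have hall : ∀ j : ℕ, (InArc a b (σ 0) ↔ InArc c d (σ 0)) ↔
      (InArc a b (σ (j : ZMod n)) ↔ InArc c d (σ (j : ZMod n))) := by
    intro j
    induction j with
    | zero => simp
    | succ j ih =>
      rw [ih, hstep]
      push_cast
      rfl
  have hall' : ∀ x, (InArc a b (σ 0) ↔ InArc c d (σ 0)) ↔ (InArc a b x ↔ InArc c d x) := by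
    intro x
    obtain ⟨k, rfl⟩ := hσ.2 x
    have := hall k.val
    rwa [ZMod.natCast_zmod_val] at this
  have ha := ZMod.val_lt a
  have hb := ZMod.val_lt b
  have hc := ZMod.val_lt c
  have hd := ZMod.val_lt d
  have va := val_add_one' (by omega) a
  have vc := val_add_one' (by omega) c
  rw [if_pos (by omega)] at va vc
  have hcontra := (hall' (a + 1)).symm.trans (hall' (c + 1))
  have e1 : InArc a b (a + 1) := by rw [inArc_iff]; omega
  have e2 : ¬ InArc c d (a + 1) := by rw [inArc_iff]; omega
  have e3 : InArc a b (c + 1) := by rw [inArc_iff]; omega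
  have e4 : InArc c d (c + 1) := by rw [inArc_iff]; omega
  tauto

/-- At all halving arcs but one, a tour misses at least two crossings. -/
theorem exists_forall_cut_add_two_le {m : ℕ} (hn : n = 2 * m) {σ : ZMod n → ZMod n}
    (hσ : Function.Bijective σ) :
    ∃ c : ZMod n, ∀ a b : ZMod n, a.val = b.val + m ∨ b.val = a.val + m → a ≠ c → b ≠ c →
      cut σ a b + 2 ≤ n := by
  have hfin : ∀ a b : ZMod n, cut σ a b ≠ n → cut σ a b + 2 ≤ n := by
    intro a b hne
    have h1 := cut_le σ a b
    obtain ⟨r, hr⟩ := cut_even hσ a b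
    omega
  by_cases hex : ∃ c d : ZMod n, d.val = c.val + m ∧ cut σ c d = n
  · obtain ⟨c, d, hcd, hcut⟩ := hex
    refine ⟨c, fun a b hab hac hbc => hfin a b fun heq => ?_⟩
    rcases hab with hab | hab
    · have hsymm : cut σ b a = n := by rwa [cut_comm]
      have h1 := eq_of_cut_eq hn hσ hab hcd hsymm hcut
      have h2 := eq_of_cut_eq hn hσ hcd hab hcut hsymm
      exact hbc (ZMod.val_injective n (by omega))
    · have h1 := eq_of_cut_eq hn hσ hab hcd heq hcut
      have h2 := eq_of_cut_eq hn hσ hcd hab hcut heq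
      exact hac (ZMod.val_injective n (by omega))
  -- No halving arc is fully crossed, so the exceptional index is arbitrary.
  · refine ⟨0, fun a b hab _ _ => hfin a b fun heq => hex ?_⟩
    rcases hab with hab | hab
    · exact ⟨b, a, hab, by rwa [cut_comm]⟩
    · exact ⟨a, b, hab, heq⟩

end Even
-- Optimality of the exchange of largest gain
section Even

variable {n : ℕ} [NeZero n]

-- The gain is the weight of a halving arc, which is why maximizing it is the right choice.
omit [NeZero n] in
theorem exchangeGain_eq_crossDiff (p : ZMod n → Plane) (i : ZMod n) :
    exchangeGain p i = crossDiff (fun i j => dist (p i) (p j)) i (i + (n / 2 : ℕ)) := by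
  simp only [exchangeGain, crossDiff]
  rw [show i + 1 + ((n / 2 : ℕ) : ZMod n) = i + (n / 2 : ℕ) + 1 by ring]

/-- The indicator of the pair `{c, c + h}` (as an ordered pair, in either order). -/
def pairIndicator (h c a b : ZMod n) : ℝ :=
  (if a = c then 1 else 0) * (if b = c + h then 1 else 0) +
    (if a = c + h then 1 else 0) * (if b = c then 1 else 0)

theorem sum_mul_pairIndicator (W : ZMod n → ZMod n → ℝ) (h c : ZMod n) :
    ∑ a, ∑ b, W a b * pairIndicator h c a b = W c (c + h) + W (c + h) c := by
  simp [pairIndicator, mul_add, Finset.sum_add_distrib]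

omit [NeZero n] in
theorem pairIndicator_eq_zero {h : ZMod n} (hh : h + h = 0) {c a b : ZMod n} (hab : b ≠ a + h) :
    pairIndicator h c a b = 0 := by
  have h1 : ¬ (a = c ∧ b = c + h) := by
    rintro ⟨rfl, h1⟩
    exact hab h1
  have h2 : ¬ (a = c + h ∧ b = c) := by
    rintro ⟨rfl, rfl⟩
    exact hab (by rw [add_assoc, hh, add_zero])
  simp only [pairIndicator, ite_zero_mul_ite_zero, if_neg h1, if_neg h2, add_zero]

omit [NeZero n] in
open Classical in
theorem pairIndicator_eq_ite {h : ZMod n} (h0 : h ≠ 0) (hh : h + h = 0) {c a b : ZMod n}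
    (hab : b = a + h) : pairIndicator h c a b = if a = c ∨ b = c then 1 else 0 := by
  subst hab
  by_cases h1 : a = c
  · subst h1
    simp [pairIndicator, h0]
  · have h2 : a = c + h ↔ a + h = c := by
      constructor
      · rintro rfl
        rw [add_assoc, hh, add_zero]
      · rintro rfl
        rw [add_assoc, hh, add_zero]
    by_cases h3 : a + h = c <;> simp [pairIndicator, h1, h2, h3]

/-- For even `n`, the exchange at `0` yields a longest tour if it is an exchange of largest
gain. -/
theorem exchange_zero_optimal {m : ℕ} (hm : 2 ≤ m) (hn : n = 2 * m) {p : ZMod n → Plane}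
    (hp : Function.Injective p)
    (hW : ∀ a b, a ≠ b → 0 < crossDiff (fun i j => dist (p i) (p j)) a b)
    (hmax : ∀ j, exchangeGain p j ≤ exchangeGain p 0) :
    ∃ τ : ZMod n → ZMod n, Function.Bijective τ ∧
      exchange p 0 (connectAll p (n / 2 - 1)) = connectAll (p ∘ τ) 1 ∧
      ∀ σ : ZMod n → ZMod n, Function.Bijective σ →
        totalLength (connectAll (p ∘ σ) 1) ≤ totalLength (connectAll (p ∘ τ) 1) := by
  obtain ⟨τ, hτ, hedge, hT⟩ := exists_exchanged_tour hm hn hp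
  refine ⟨τ, hτ, hT.symm, fun σ hσ => ?_⟩
  have hn2 : 2 < n := by omega
  have hdiv : n / 2 = m := by omega
  have hd : ∀ x y, dist (p x) (p y) = dist (p y) (p x) := fun x y => dist_comm _ _
  have hd0 : ∀ x, dist (p x) (p x) = 0 := fun x => dist_self _
  rw [totalLength_connectAll_one hn2 (hp.comp hσ.1), totalLength_connectAll_one hn2 (hp.comp hτ.1)]
  have e1 := four_mul_sum_eq_sum_cut (by omega) (fun i j => dist (p i) (p j)) hd hd0 τ
  have e2 := four_mul_sum_eq_sum_cut (by omega) (fun i j => dist (p i) (p j)) hd hd0 σ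
  simp only [Function.comp]
  obtain ⟨c, hc⟩ := exists_forall_cut_add_two_le hn hσ
  have hgain : ∀ i, exchangeGain p i = crossDiff (fun i j => dist (p i) (p j)) i (i + (m : ℕ)) :=
    fun i => by rw [exchangeGain_eq_crossDiff, hdiv]
  have hWc : ∀ a b, crossDiff (fun i j => dist (p i) (p j)) a b =
      crossDiff (fun i j => dist (p i) (p j)) b a := crossDiff_comm _ hd
  set W := crossDiff fun i j => dist (p i) (p j) with hWdef
  have hm0 : (m : ZMod n) ≠ 0 := by
    rw [Ne, ← ZMod.val_eq_zero, ZMod.val_natCast_of_lt (by omega)]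
    omega
  have hmm : (m : ZMod n) + m = 0 := by
    have : ((2 * m : ℕ) : ZMod n) = 0 := by
      rw [← hn]
      simp
    push_cast at this
    linear_combination this
  have hhalf : ∀ a b : ZMod n, b = a + (m : ZMod n) ↔ a.val = b.val + m ∨ b.val = a.val + m := by
    intro a b
    have h1 := val_add_natCast a (u := m) (by omega)
    have ha := ZMod.val_lt a
    have hb := ZMod.val_lt b
    rw [← (ZMod.val_injective n).eq_iff, h1]
    split_ifs <;> omega
  -- Arc by arc, `τ` loses to `σ` only at the pair of `c`, by at most 2 crossings, and wins at least
  -- 2 at the pair of `0`. If the pairs coincide, both corrections cancel.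
  have key : ∀ a b, W a b * (2 * pairIndicator (m : ZMod n) 0 a b)
      - W a b * (2 * pairIndicator (m : ZMod n) c a b) ≤
      W a b * cut τ a b - W a b * cut σ a b := by
    intro a b
    rw [← mul_sub (W a b), ← mul_sub (W a b)]
    by_cases hab : b = a + (m : ZMod n)
    · have hne : a ≠ b := by
        rintro rfl
        exact hm0 (by simpa using hab)
      refine mul_le_mul_of_nonneg_left ?_ (hW a b hne).le
      rw [pairIndicator_eq_ite hm0 hmm hab, pairIndicator_eq_ite hm0 hmm hab]
      rw [hhalf] at hab
      have hστ : (if a = 0 ∨ b = 0 then 2 else 0) + cut σ a b ≤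
          cut τ a b + if a = c ∨ b = c then 2 else 0 := by
        have hσn := cut_le σ a b
        have hτn := le_cut_add_two hm hn hτ hedge hab
        have hσc : ¬ (a = c ∨ b = c) → cut σ a b + 2 ≤ n := fun h => by
          push Not at h
          exact hc a b hab h.1 h.2
        have hτ0 : a = 0 ∨ b = 0 → cut τ a b = n := fun h => by
          have hlt := ZMod.val_lt a
          have hlt' := ZMod.val_lt b
          rw [← ZMod.val_eq_zero a, ← ZMod.val_eq_zero b] at h
          exact (cut_eq_iff τ a b).2 fun k => exchangedEdge_separates hm hn (hedge k) (by omega)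
        split_ifs with h1 h2 h2
        · have := hτ0 h1
          omega
        · have := hτ0 h1
          have := hσc h2
          omega
        · omega
        · have := hσc h2
          omega
      have hστ' : ((if a = 0 ∨ b = 0 then 2 else 0) + cut σ a b : ℝ) ≤
          cut τ a b + if a = c ∨ b = c then 2 else 0 := by exact_mod_cast hστ
      simp only [mul_ite, mul_one, mul_zero]
      linarith
    · rw [pairIndicator_eq_zero hmm hab, pairIndicator_eq_zero hmm hab, sub_self]
      by_cases hne : a = b
      · rw [hne, cut_self, cut_self, sub_self, mul_zero]
      refine mul_le_mul_of_nonneg_left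
        (sub_nonneg.2 (Nat.cast_le.2 (cut_le_cut hτ hσ a b ?_))) (hW a b hne).le
      rw [hhalf] at hab
      by_cases hlt : a.val < b.val + m ∧ b.val < a.val + m
      · exact Or.inl fun k => (exchangedEdge_not_same_side hm hn (hedge k)).1 hlt
      · exact Or.inr fun k => (exchangedEdge_not_same_side hm hn (hedge k)).2 (by omega)
  have hsum : ∑ a, ∑ b, (W a b * (2 * pairIndicator (m : ZMod n) 0 a b)
      - W a b * (2 * pairIndicator (m : ZMod n) c a b)) ≤
      ∑ a, ∑ b, (W a b * cut τ a b - W a b * cut σ a b) :=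
    Finset.sum_le_sum fun a _ => Finset.sum_le_sum fun b _ => key a b
  simp only [Finset.sum_sub_distrib, mul_left_comm _ (2 : ℝ), ← Finset.mul_sum] at hsum
  -- Each pair occurs in both orders, so four times the length difference is at least four times the
  -- difference of the gains at `0` and `c`.
  rw [sum_mul_pairIndicator, sum_mul_pairIndicator, ← e1, ← e2, hWc (0 + _), hWc (c + _),
    ← hgain, ← hgain] at hsum
  linarith [hmax c]

theorem connectAll_rotate (p : ZMod n → Plane) (i : ZMod n) (k : ℕ) :
    connectAll (fun j => p (i + j)) k = connectAll p k := by
  ext e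
  rw [mem_connectAll, mem_connectAll]
  constructor
  · rintro ⟨j, rfl⟩
    exact ⟨i + j, by rw [add_assoc]⟩
  · rintro ⟨j, rfl⟩
    exact ⟨j - i, by rw [← add_assoc, add_sub_cancel]⟩

omit [NeZero n] in
theorem exchange_rotate (p : ZMod n → Plane) (i j : ZMod n) (T : Finset (Sym2 Plane)) :
    exchange (fun j => p (i + j)) j T = exchange p (i + j) T := by
  simp only [exchange, add_assoc]

omit [NeZero n] in
theorem exchangeGain_rotate (p : ZMod n → Plane) (i j : ZMod n) :
    exchangeGain (fun j => p (i + j)) j = exchangeGain p (i + j) := by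
  simp only [exchangeGain, add_assoc]

omit [NeZero n] in
theorem crossDiff_rotate (d : ZMod n → ZMod n → ℝ) (i a b : ZMod n) :
    crossDiff (fun x y => d (i + x) (i + y)) a b = crossDiff d (i + a) (i + b) := by
  simp only [crossDiff, add_assoc]

/-- For even `n`, an exchange of largest gain yields a longest tour. -/
theorem exchange_optimal {m : ℕ} (hm : 2 ≤ m) (hn : n = 2 * m) {p : ZMod n → Plane}
    (hp : Function.Injective p)
    (hW : ∀ a b, a ≠ b → 0 < crossDiff (fun i j => dist (p i) (p j)) a b) {i : ZMod n}
    (hmax : ∀ j, exchangeGain p j ≤ exchangeGain p i) :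
    ∃ τ : ZMod n → ZMod n, Function.Bijective τ ∧
      exchange p i (connectAll p (n / 2 - 1)) = connectAll (p ∘ τ) 1 ∧
      ∀ σ : ZMod n → ZMod n, Function.Bijective σ →
        totalLength (connectAll (p ∘ σ) 1) ≤ totalLength (connectAll (p ∘ τ) 1) := by
  have hadd : Function.Bijective fun j : ZMod n => i + j := (Equiv.addLeft i).bijective
  -- Rotating the enumeration by `i` moves the exchange to index 0.
  obtain ⟨τ, hτ, hT, hopt⟩ := exchange_zero_optimal (p := fun j => p (i + j)) hm hn
    (hp.comp hadd.1)
    (fun a b hab => by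
      rw [crossDiff_rotate fun x y => dist (p x) (p y)]
      exact hW _ _ (by simpa using hab))
    (fun j => by
      rw [exchangeGain_rotate, exchangeGain_rotate, add_zero]
      exact hmax _)
  rw [exchange_rotate, connectAll_rotate, add_zero] at hT
  refine ⟨fun k => i + τ k, hadd.comp hτ, hT, fun σ hσ => ?_⟩
  have h := hopt (fun k => σ k - i) ((Equiv.subRight i).bijective.comp hσ)
  have e : ((fun j => p (i + j)) ∘ fun k => σ k - i) = p ∘ σ := by
    funext k
    simp
  rwa [e] at h

end Even

/-! ### Existence of an output -/

/-- Compactness gives a minimizer over the hull. It is global, since projecting a point onto the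
hull does not increase its distance to any point of `P`. -/
theorem exists_isApproxCenter {P : Finset Plane} (hP : P.Nonempty) {ε : ℝ} (hε : 0 ≤ ε) :
    ∃ c, IsApproxCenter P ε c := by
  have hne : (convexHull ℝ (P : Set Plane)).Nonempty := by
    rw [convexHull_nonempty_iff]
    exact_mod_cast hP
  have hcompact : IsCompact (convexHull ℝ (P : Set Plane)) :=
    P.finite_toSet.isCompact_convexHull ℝ
  have hcont : Continuous (fermatWeber P) := by
    unfold fermatWeber
    fun_prop
  obtain ⟨c, hc, hmin⟩ := hcompact.exists_isMinOn hne hcont.continuousOn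
  refine ⟨c, hc, fun x => ?_⟩
  obtain ⟨v, hv, hvmin⟩ := exists_norm_eq_iInf_of_complete_convex hne hcompact.isComplete
    (convex_convexHull ℝ _) x
  rw [norm_eq_iInf_iff_real_inner_le_zero (convex_convexHull ℝ _) hv] at hvmin
  have hle : fermatWeber P v ≤ fermatWeber P x := by
    refine Finset.sum_le_sum fun w hw => ?_
    have h := hvmin w (subset_convexHull ℝ _ (by exact_mod_cast hw))
    rw [dist_eq_norm, dist_eq_norm]
    refine abs_le_of_sq_le_sq' ?_ (norm_nonneg _) |>.2
    have h1 : x - w = (x - v) - (w - v) := by abel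
    have h2 : ‖v - w‖ = ‖w - v‖ := norm_sub_rev _ _
    rw [h1, h2, norm_sub_sq_real (x - v) (w - v)]
    nlinarith [sq_nonneg ‖x - v‖]
  have := hmin hv
  simp only [Set.mem_ofPred_eq] at this
  linarith

theorem exists_polar (v : Plane) :
    ∃ t : ℝ, -Real.pi < t ∧ t ≤ Real.pi ∧ v = ‖v‖ • unitVec t := by
  set z : ℂ := ⟨v 0, v 1⟩ with hz
  have hnorm : ‖v‖ = ‖z‖ := by
    rw [EuclideanSpace.norm_eq, Complex.norm_eq_sqrt_sq_add_sq]
    simp [Fin.sum_univ_two, hz]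
  refine ⟨z.arg, Complex.neg_pi_lt_arg z, Complex.arg_le_pi z, ?_⟩
  rw [hnorm]
  apply plane_ext
  · simp [unitVec, Complex.norm_mul_cos_arg, hz]
  · simp [unitVec, Complex.norm_mul_sin_arg, hz]

theorem exists_isAngle {P : Finset Plane} (hP : 2 ≤ P.card) (c : Plane) {x : Plane} :
    ∃ t : ℝ, -Real.pi < t ∧ t ≤ Real.pi ∧ IsAngle P c x t := by
  by_cases hxc : x = c
  -- The direction from another point `y` to the centre is admissible: its opposite leads back to
  -- `y`.
  · obtain ⟨y, hy, hyc⟩ := Finset.exists_mem_ne (by omega : 1 < P.card) c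
    obtain ⟨t, h1, h2, h3⟩ := exists_polar (c - y)
    refine ⟨t, h1, h2, by simp [hxc], fun _ =>
      ⟨‖c - y‖, norm_pos_iff.2 (sub_ne_zero.2 hyc.symm), ?_⟩⟩
    rw [← h3, sub_sub_cancel]
    exact subset_convexHull ℝ _ (by exact_mod_cast hy)
  · obtain ⟨t, h1, h2, h3⟩ := exists_polar (x - c)
    refine ⟨t, h1, h2, ?_, fun h => absurd h hxc⟩
    rw [dist_eq_norm, ← h3, add_sub_cancel]

theorem exists_isAngularOrder {P : Finset Plane} (hP : 2 ≤ P.card) (c : Plane) :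
    ∃ p : ZMod P.card → Plane, IsAngularOrder P c p := by
  have : NeZero P.card := ⟨by omega⟩
  choose φ h1 h2 h3 using fun x => exists_isAngle hP c (x := x)
  let e : Fin P.card ≃ P := P.equivFin.symm
  let f : Fin P.card → ℝ := fun i => φ (e i)
  let g : Fin P.card → Plane := fun i => e (Tuple.sort f i)
  have hg : Function.Injective g :=
    Subtype.val_injective.comp (e.injective.comp (Tuple.sort f).injective)
  have hgr : Set.range g = (P : Set Plane) := by
    ext x
    constructor
    · rintro ⟨i, rfl⟩
      exact (e (Tuple.sort f i)).2
    · intro hx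
      exact ⟨(Tuple.sort f).symm (e.symm ⟨x, by exact_mod_cast hx⟩), by simp [g]⟩
  have hmono : Monotone fun i => φ (g i) := Tuple.monotone_sort f
  let idx : ZMod P.card → Fin P.card := fun k => ⟨k.val, ZMod.val_lt k⟩
  have hidx : Function.Bijective idx := by
    constructor
    · intro i j hij
      exact ZMod.val_injective _ (congrArg Fin.val hij)
    · intro i
      exact ⟨((i : ℕ) : ZMod P.card), Fin.ext (ZMod.val_natCast_of_lt i.2)⟩
  have hidxn : ∀ i (hi : i < P.card), idx (i : ℕ) = ⟨i, hi⟩ := fun i hi =>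
    Fin.ext (ZMod.val_natCast_of_lt hi)
  refine ⟨g ∘ idx, ⟨hg.comp hidx.1, by rw [hidx.2.range_comp, hgr]⟩,
    fun i => φ (g (idx (i : ℕ))), fun i j hij hj => ?_, fun i _ => ?_, fun i _ => ?_, fun i _ => ?_⟩
  · apply hmono
    rw [hidxn j hj, hidxn i (by omega)]
    exact hij
  -- All angles lie in the half-open interval (-π, π], so they differ by less than 2π.
  · have := h1 (g (idx ((0 : ℕ) : ZMod P.card)))
    have := h2 (g (idx (i : ZMod P.card)))
    linarith
  · exact (h3 _).1
  · exact (h3 _).2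

theorem exists_tourFromOrder {n : ℕ} [NeZero n] (p : ZMod n → Plane) : ∃ T, TourFromOrder p T := by
  rcases Nat.even_or_odd n with h | h
  · obtain ⟨i, hi⟩ := Finite.exists_max (exchangeGain p)
    exact ⟨_, Or.inr ⟨h, i, hi, rfl⟩⟩
  · exact ⟨_, Or.inl ⟨h, rfl⟩⟩

end MaxTSP

theorem theorem5 (P : Finset MaxTSP.Plane) (hn : 3 ≤ P.card) (hP : MaxTSP.InConvexPosition P)
    (ε : ℝ) (hε : 0 ≤ ε) :
    (∃ T : Finset (Sym2 MaxTSP.Plane), MaxTSP.IsCrossOutput P ε T) ∧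
    (∀ T : Finset (Sym2 MaxTSP.Plane), MaxTSP.IsCrossOutput P ε T → MaxTSP.IsMaxTour P T) ∧
    (Odd P.card →
      ∀ (c : MaxTSP.Plane) (p : ZMod P.card → MaxTSP.Plane),
        c ∈ convexHull ℝ (P : Set MaxTSP.Plane) → MaxTSP.IsAngularOrder P c p →
        ∀ T : Finset (Sym2 MaxTSP.Plane),
          MaxTSP.IsMaxTour P T ↔ T = MaxTSP.connectAll p ((P.card - 1) / 2)) := by
  have : NeZero P.card := ⟨by omega⟩
  have hodd : Odd P.card →
      ∀ (c : MaxTSP.Plane) (p : ZMod P.card → MaxTSP.Plane),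
        c ∈ convexHull ℝ (P : Set MaxTSP.Plane) → MaxTSP.IsAngularOrder P c p →
        ∀ T : Finset (Sym2 MaxTSP.Plane),
          MaxTSP.IsMaxTour P T ↔ T = MaxTSP.connectAll p ((P.card - 1) / 2) := by
    rintro ⟨u, hu⟩ c p hc hp T
    have hp1 := hp.1
    obtain ⟨τ, hτ, hT, hopt⟩ := MaxTSP.nearDiagonals_optimal (by omega) hu hp1.1
      fun a b hab => MaxTSP.crossDiff_pos (by omega) (hp.positivelyOriented hP hc) hab
    rw [show (P.card - 1) / 2 = u by omega]
    have htour : MaxTSP.IsTour P (MaxTSP.connectAll p u) :=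
      (MaxTSP.isTour_iff hp1).2 ⟨τ, hτ, hT.symm⟩
    constructor
    · rintro ⟨hT1, hT2⟩
      obtain ⟨σ, hσ, rfl⟩ := (MaxTSP.isTour_iff hp1).1 hT1
      exact (hopt σ hσ).2 (le_antisymm (hopt σ hσ).1 (hT2 _ htour))
    · rintro rfl
      refine ⟨htour, fun T' hT' => ?_⟩
      obtain ⟨σ, hσ, rfl⟩ := (MaxTSP.isTour_iff hp1).1 hT'
      exact (hopt σ hσ).1
  refine ⟨?_, ?_, hodd⟩
  · obtain ⟨c, hc⟩ := MaxTSP.exists_isApproxCenter (P := P) (Finset.card_pos.1 (by omega)) hε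
    obtain ⟨p, hp⟩ := MaxTSP.exists_isAngularOrder (P := P) (by omega) c
    obtain ⟨T, hT⟩ := MaxTSP.exists_tourFromOrder p
    exact ⟨T, c, hc, p, hp, hT⟩
  · rintro T ⟨c, ⟨hc, _⟩, p, hp, ⟨h, hT⟩ | ⟨⟨m, hm⟩, i, hi, rfl⟩⟩
    · exact (hodd h c p hc hp T).2 hT
    · have hp1 := hp.1
      obtain ⟨τ, hτ, hT, hopt⟩ := MaxTSP.exchange_optimal (m := m) (by omega) (by omega) hp1.1
        (fun a b hab => MaxTSP.crossDiff_pos (by omega) (hp.positivelyOriented hP hc) hab) hi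
      rw [hT]
      refine ⟨(MaxTSP.isTour_iff hp1).2 ⟨τ, hτ, rfl⟩, fun T' hT' => ?_⟩
      obtain ⟨σ, hσ, rfl⟩ := (MaxTSP.isTour_iff hp1).1 hT'
      exact hopt σ hσ
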